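/- **Setting.** Consider the problem: minimize $f(x)$ subject to $g(x)\in\Theta$, where $f:\mathbb R^n\to\mathbb R$, $g:\mathbb R^n\to\mathbb R^m$, and $\Theta\subset\mathbb R^m$ is a convex polyhedron (a finite intersection of closed half-spaces). Put $\Gamma:=\{x\mid g(x)\in\Theta\}$, let $\delta_\Gamma$ be $0$ on $\Gamma$ and $\infty$ elsewhere, and let $\varphi:=f+\delta_\Gamma$. For $\varphi:\mathbb R^n\to(-\infty,\infty]$ and $\varphi(x)<\infty$, let $\widehat\partial\varphi(x):=\{v\mid\liminf_{u\to x}\frac{\varphi(u)-\varphi(x)-\langle v,u-x\rangle}{\|u-x\|}\ge 0\}$, and let $\partial\varphi(x)$ be the set of all limits of $v_k\in\widehat\partial\varphi(x_k)$ with $x_k\to x$ and $\varphi(x_k)\to\varphi(x)$; both sets are empty where $\varphi=\infty$. For a set $\Omega$ let $N_\Omega(x):=\partial\delta_\Omega(x)$, let $T_\Omega(x)$ be the set of all $w$ for which there are $t_k\downarrow0$ and $w_k\to w$ with $x+t_kw_k\in\Omega$, and let $K_\Omega(x,v):=T_\Omega(x)\cap\{v\}^\perp$. The multiplier set is $$\Lambda(x,v):=\{y\in\mathbb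 R^m\mid v=\nabla f(x)+\nabla g(x)^*y,\ y\in N_\Theta(g(x))\}.$$ A function $\varphi$ is *variationally convex* at $\bar x$ for $\bar v\in\partial\varphi(\bar x)$ if there are a convex neighborhood $U\times V$ of $(\bar x,\bar v)$ with $\varphi$ l.s.c. on $U$, an l.s.c. convex function $\psi:\mathbb R^n\to(-\infty,\infty]$ with $\psi\le\varphi$ on $U$, and $\varepsilon>0$ such that, with $U_\varepsilon:=\{x\in U\mid\varphi(x)<\varphi(\bar x)+\varepsilon\}$, $$(U_\varepsilon\times V)\cap\operatorname{gph}\partial\varphi=(U\times V)\cap\operatorname{gph}\partial\psi\quad\text{and}\quad\varphi(x)=\psi(x)\ \text{at the common elements }(x,v).$$ It is *strongly variationally convex* with modulus $\sigma>0$ if moreover $\psi$ can be chosen strongly convex on $U$ with modulus $\sigma$. A point $\bar x$ with $\varphi(\bar x)<\infty$ is a *strong local minimizer* of $\varphi$ with modulus $\sigma>0$ if $\varphi(x)\ge\varphi(\bar x)+\frac\sigma2\|x-\bar x\|^2$ for all $x$ near $\bar x$. It is a *tilt-stable local minimizer* of $\varphi$ with modulus $\kappa$ if for some $\gamma>0$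 the mapping $M_\gamma(v):=\operatorname{argmin}\{\varphi(x)-\langle v,x\rangle\mid\|x-\bar x\|\le\gamma\}$ is single-valued and Lipschitz with constant $\kappa$ on some neighborhood of $0$, and $M_\gamma(0)=\{\bar x\}$. **Theorem.** Let $f$ and $g$ be $\mathcal C^2$-smooth around $\bar x\in\Gamma$, let the first-order condition $\nabla f(\bar x)+\nabla g(\bar x)^*\bar y=0$ hold for some $\bar y\in N_\Theta(g(\bar x))$, and let MSCQ hold at $\bar x$: for some $\kappa>0$, $\operatorname{dist}(x;\Gamma)\le\kappa\operatorname{dist}(g(x);\Theta)$ for all $x$ near $\bar x$. (i) If there are neighborhoods $U$ of $\bar x$ and $V$ of $0$ such that $$\langle\nabla^2f(x)w,w\rangle+\langle w,\nabla^2\langle y,g\rangle(x)w\rangle\ge0$$ for all $x\in U$, $v\in V$, $w\in-K_\Gamma(x,v-\nabla f(x))$ and $y\in\Lambda(x,v)$, then $f+\delta_\Gamma$ is variationally convex at $\bar x$ for $0$. Consequently, $\bar x$ is a local minimizer of the constrained problem. (ii) Let $\sigma>0$. If there are neighborhoods $U$ of $\bar x$ and $V$ of $0$ such that $$\langle\nabla^2f(x)w,w\rangle+\langle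 w,\nabla^2\langle y,g\rangle(x)w\rangle\ge\sigma\|w\|^2$$ for all $x\in U$, $v\in V$, $w\in-K_\Gamma(x,v-\nabla f(x))$ and $y\in\Lambda(x,v)$, then $f+\delta_\Gamma$ is strongly variationally convex at $\bar x$ for $0$ with modulus $\sigma$. Consequently, $\bar x$ is a strong local minimizer of $f+\delta_\Gamma$ with modulus $\sigma$, and it is a tilt-stable local minimizer of $f+\delta_\Gamma$ with modulus $\sigma^{-1}$. -/

import Mathlib

open Filter Topology

noncomputable section

namespace VariationalAnalysis

variable {E F : Type*} [NormedAddCommGroup E] [InnerProductSpace ℝ E]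
  [NormedAddCommGroup F] [InnerProductSpace ℝ F]

/-! ### Subdifferentials and normal cones -/

open Classical in
/-- The indicator function `δ_Ω`: it is `0` on `Ω` and `∞` elsewhere. -/
def indicatorFun (Ω : Set E) (x : E) : EReal := if x ∈ Ω then 0 else ⊤

/-- The Fréchet (regular) subdifferential of an extended-real-valued function. The condition
`liminf_{u → x} (φ u - φ x - ⟪v, u - x⟫) / ‖u - x‖ ≥ 0` is written in its `ε`-form. The set is
empty at points where `φ` is not finite. -/
def regularSubdiff (φ : E → EReal) (x : E) : Set E :=
  {v | φ x ≠ ⊤ ∧ φ x ≠ ⊥ ∧ ∀ ε : ℝ, 0 < ε → ∀ᶠ u in 𝓝 x,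
    φ x + ((inner ℝ v (u - x) - ε * ‖u - x‖ : ℝ) : EReal) ≤ φ u}

/-- The Mordukhovich (limiting) subdifferential: limits of regular subgradients `v_k` at points
`x_k → x` with `φ x_k → φ x`. The set is empty at points where `φ` is not finite. -/
def limitingSubdiff (φ : E → EReal) (x : E) : Set E :=
  {v | φ x ≠ ⊤ ∧ φ x ≠ ⊥ ∧ ∃ (xs vs : ℕ → E),
    Tendsto xs atTop (𝓝 x) ∧ Tendsto (fun k => φ (xs k)) atTop (𝓝 (φ x)) ∧
    Tendsto vs atTop (𝓝 v) ∧ ∀ k, vs k ∈ regularSubdiff φ (xs k)}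

/-- The limiting normal cone `N_Ω(x) = ∂δ_Ω(x)` (empty for `x ∉ Ω`). -/
def normalCone (Ω : Set E) (x : E) : Set E := limitingSubdiff (indicatorFun Ω) x

/-- The Bouligand (contingent) tangent cone: limits `w` of `w_k` with `x + t_k w_k ∈ Ω` for some
`t_k ↓ 0`. -/
def contingentCone (Ω : Set E) (x : E) : Set E :=
  {w | ∃ (t : ℕ → ℝ) (ws : ℕ → E), (∀ k, 0 < t k) ∧ Tendsto t atTop (𝓝 0) ∧
    Tendsto ws atTop (𝓝 w) ∧ ∀ k, x + t k • ws k ∈ Ω}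

/-- The critical cone `K_Ω(x, v) = T_Ω(x) ∩ {v}^⊥`. -/
def criticalCone (Ω : Set E) (x v : E) : Set E :=
  {w | w ∈ contingentCone Ω x ∧ inner ℝ v w = 0}

/-! ### Variational convexity -/

/-- `ψ` satisfies the convexity inequality with modulus `σ` on `U`; `σ = 0` is convexity, `σ > 0`
is strong convexity with modulus `σ`. (For `ψ` with values in `(-∞, ∞]`.) -/
def ConvexOnWithModulus (U : Set E) (σ : ℝ) (ψ : E → EReal) : Prop :=
  ∀ x ∈ U, ∀ y ∈ U, ∀ a b : ℝ, 0 < a → 0 < b → a + b = 1 →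
    ψ (a • x + b • y) + ((a * b * (σ / 2 * ‖x - y‖ ^ 2) : ℝ) : EReal)
      ≤ (a : EReal) * ψ x + (b : EReal) * ψ y

/-- The common form of variational convexity (`σ = 0`) and strong variational convexity with
modulus `σ > 0` of `φ` at `x̄` for `v̄ ∈ ∂φ(x̄)`. All requirements concern `φ` near `x̄` only, and so
does the lower semicontinuity of `φ`. The convex function `ψ` is proper and lower semicontinuous
on the whole space, with values in `(-∞, ∞]`. -/
def VariationallyConvexWithModulus (φ : E → EReal) (xbar vbar : E) (σ : ℝ) : Prop :=
  vbar ∈ limitingSubdiff φ xbar ∧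
  ∃ U ∈ 𝓝 xbar, ∃ V ∈ 𝓝 vbar, Convex ℝ U ∧ Convex ℝ V ∧ LowerSemicontinuousOn φ U ∧
    ∃ ψ : E → EReal, (∀ x, ψ x ≠ ⊥) ∧ LowerSemicontinuous ψ ∧
      ConvexOnWithModulus Set.univ 0 ψ ∧ ConvexOnWithModulus U σ ψ ∧ (∀ x ∈ U, ψ x ≤ φ x) ∧
      ∃ ε : ℝ, 0 < ε ∧
        (∀ x ∈ U, ∀ v ∈ V,
          (φ x < φ xbar + (ε : EReal) ∧ v ∈ limitingSubdiff φ x) ↔ v ∈ limitingSubdiff ψ x) ∧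
        (∀ x ∈ U, ∀ v ∈ V, v ∈ limitingSubdiff ψ x → φ x = ψ x)

/-- Variational convexity of `φ` at `x̄` for `v̄`. -/
def VariationallyConvex (φ : E → EReal) (xbar vbar : E) : Prop :=
  VariationallyConvexWithModulus φ xbar vbar 0

/-- Strong variational convexity of `φ` at `x̄` for `v̄` with modulus `σ > 0`. -/
def StronglyVariationallyConvex (φ : E → EReal) (xbar vbar : E) (σ : ℝ) : Prop :=
  0 < σ ∧ VariationallyConvexWithModulus φ xbar vbar σ

/-! ### Local minimizers -/

/-- `x̄` is a strong local minimizer of `φ` with modulus `σ > 0`. -/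
def IsStrongLocalMinimizer (φ : E → EReal) (xbar : E) (σ : ℝ) : Prop :=
  0 < σ ∧ φ xbar ≠ ⊤ ∧
    ∀ᶠ x in 𝓝 xbar, φ xbar + ((σ / 2 * ‖x - xbar‖ ^ 2 : ℝ) : EReal) ≤ φ x

/-- `M_γ(v)`, the set of minimizers of `φ - ⟪v, ·⟫` over the closed ball of radius `γ`. -/
def tiltArgmin (φ : E → EReal) (xbar : E) (γ : ℝ) (v : E) : Set E :=
  {x | x ∈ Metric.closedBall xbar γ ∧ ∀ u ∈ Metric.closedBall xbar γ,
    φ x - ((inner ℝ v x : ℝ) : EReal) ≤ φ u - ((inner ℝ v u : ℝ) : EReal)}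

/-- `x̄` is a tilt-stable local minimizer of `φ` with modulus `κ`: for some `γ > 0` the mapping
`M_γ` is single-valued and `κ`-Lipschitz on a neighborhood of `0`, with `M_γ(0) = {x̄}`. -/
def IsTiltStableLocalMinimizer (φ : E → EReal) (xbar : E) (κ : ℝ) : Prop :=
  0 ≤ κ ∧ φ xbar ≠ ⊤ ∧ ∃ γ : ℝ, 0 < γ ∧ tiltArgmin φ xbar γ 0 = {xbar} ∧
    ∃ V ∈ 𝓝 (0 : E), ∃ m : E → E, (∀ v ∈ V, tiltArgmin φ xbar γ v = {m v}) ∧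
      ∀ v₁ ∈ V, ∀ v₂ ∈ V, ‖m v₁ - m v₂‖ ≤ κ * ‖v₁ - v₂‖

/-! ### The constrained problem: minimize `f x` subject to `g x ∈ Θ` -/

/-- Convex polyhedra: intersections of finitely many closed half-spaces. -/
def IsConvexPolyhedron (Θ : Set F) : Prop :=
  ∃ (p : ℕ) (a : Fin p → F) (b : Fin p → ℝ), Θ = {z | ∀ i, inner ℝ (a i) z ≤ b i}

/-- The feasible set `Γ = {x | g x ∈ Θ}`. -/
def feasibleSet (g : E → F) (Θ : Set F) : Set E := {x | g x ∈ Θ}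

/-- The extended-real-valued cost `f + δ_Γ`. -/
def constrainedCost (f : E → ℝ) (g : E → F) (Θ : Set F) (x : E) : EReal :=
  (f x : EReal) + indicatorFun (feasibleSet g Θ) x

/-- The metric subregularity constraint qualification at the feasible point `x̄`. -/
def MSCQ (g : E → F) (Θ : Set F) (xbar : E) : Prop :=
  xbar ∈ feasibleSet g Θ ∧ ∃ κ : ℝ, 0 < κ ∧ ∀ᶠ x in 𝓝 xbar,
    Metric.infDist x (feasibleSet g Θ) ≤ κ * Metric.infDist (g x) Θ

variable [CompleteSpace E] [CompleteSpace F]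

/-- The multiplier set `Λ(x, v) = {y | v = ∇f(x) + ∇g(x)^* y, y ∈ N_Θ(g x)}`. -/
def multiplierSet (f : E → ℝ) (g : E → F) (Θ : Set F) (x v : E) : Set F :=
  {y | v = gradient f x + (fderiv ℝ g x).adjoint y ∧ y ∈ normalCone Θ (g x)}

/-- The first-order optimality condition at `x̄`: `∇f(x̄) + ∇g(x̄)^* ȳ = 0` for some
`ȳ ∈ N_Θ(g x̄)`. -/
def FirstOrderCondition (f : E → ℝ) (g : E → F) (Θ : Set F) (xbar : E) : Prop :=
  ∃ ybar ∈ normalCone Θ (g xbar), gradient f xbar + (fderiv ℝ g xbar).adjoint ybar = 0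

/-- The Hessian quadratic form `⟪∇²h(x) w, w⟫`. -/
def hessianForm (h : E → ℝ) (x w : E) : ℝ := inner ℝ (fderiv ℝ (gradient h) x w) w

/-- The second-order condition with constant `σ`: on neighborhoods of `x̄` and `0`,
`⟪∇²f(x) w, w⟫ + ⟪w, ∇²⟨y, g⟩(x) w⟫ ≥ σ ‖w‖²` for all `w ∈ -K_Γ(x, v - ∇f(x))` and all
multipliers `y ∈ Λ(x, v)`. -/
def SecondOrderCondition (f : E → ℝ) (g : E → F) (Θ : Set F) (xbar : E) (σ : ℝ) : Prop :=
  ∃ U ∈ 𝓝 xbar, ∃ V ∈ 𝓝 (0 : E), ∀ x ∈ U, ∀ v ∈ V,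
    ∀ w : E, -w ∈ criticalCone (feasibleSet g Θ) x (v - gradient f x) →
      ∀ y ∈ multiplierSet f g Θ x v,
        σ * ‖w‖ ^ 2 ≤ hessianForm f x w + hessianForm (fun z => inner ℝ y (g z)) x w

end VariationalAnalysis

end

namespace VariationalAnalysis

/-! ### Limiting normals and subgradients of convex objects agree with those of convex analysis. -/

section Normals

variable {E F : Type*}

/-! Write `φ = f + δ_Γ`. The second-order condition is turned into positivity of the graphical
derivative of `∂φ` near `(x̄, 0)`, and this infinitesimal inequality is then integrated along the
gradient of a Moreau envelope. The case `σ = 0` runs through the same argument as `σ > 0`.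

Multipliers. MSCQ and a separation argument give every subgradient of `φ` near `(x̄, 0)` a
multiplier of uniformly bounded norm (`exists_bounded_multiplier`). With Taylor's formula this
yields prox-regularity: `f(u) ≥ f(x) + ⟨v, u - x⟩ - r/2 ‖u - x‖²` on the local graph
(`exists_prox_regular`).

Graphical derivative. If `(x + t_k w_k, v + t_k q_k)` lies in the graph with `t_k ↓ 0`, `w_k → w`,
`q_k → q`, then multipliers converge along a subsequence to some `y ∈ Λ(x, v)`. Monotonicity of the
normal cone of the convex set `Θ` shows that `w` is critical and that the Hessian form of the
Lagrangian at `w` is at most `⟨q, w⟩` (`hessianForm_le_of_tendsto`). Hence `σ‖w‖² ≤ ⟨q, w⟩`.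

Integration. For `s = 4r` the localized proximal map `P` is Lipschitz, and `s(z - P z)` serves as
the gradient of the envelope. Limits of its difference quotients are governed by the graphical
derivative, so it is strongly monotone with modulus `σs/(σ + s)`, and the envelope inherits strong
convexity with that modulus. Undoing the envelope recovers the modulus `σ` for `φ`: `f(u) ≥ f(x) +
⟨v, u - x⟩ + σ/2 ‖u - x‖²` for all graph points `(x, v)` near `(x̄, 0)` and feasible `u` near `x̄`
(`exists_uniform_growth`).

Conclusions. The supremum `ψ` of these quadratic minorants is the required convex function. At `(x̄,
0)` the inequality is the growth condition, and comparing it at two minimizers gives tilt stability.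
-/

theorem constrainedCost_of_mem {f : E → ℝ} {g : E → F} {Θ : Set F} {x : E} (hx : g x ∈ Θ) :
    constrainedCost f g Θ x = (f x : EReal) := by
  simp [constrainedCost, indicatorFun, feasibleSet, hx]

theorem constrainedCost_of_notMem {f : E → ℝ} {g : E → F} {Θ : Set F} {x : E} (hx : g x ∉ Θ) :
    constrainedCost f g Θ x = ⊤ := by
  simp [constrainedCost, indicatorFun, feasibleSet, hx]

/-- Makes normal cones the case `f = 0`, `g = id` of the subdifferential of `f + δ_Γ`, so both share
one description of regular subgradients. -/
theorem constrainedCost_zero_id (Ω : Set E) :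
    constrainedCost (fun _ => 0) id Ω = indicatorFun Ω := by
  funext x
  simp [constrainedCost, feasibleSet]

theorem le_constrainedCost_iff {f : E → ℝ} {g : E → F} {Θ : Set F} {x : E} {c : ℝ} :
    (c : EReal) ≤ constrainedCost f g Θ x ↔ (g x ∈ Θ → c ≤ f x) := by
  by_cases hx : g x ∈ Θ
  · simp [constrainedCost_of_mem hx, hx]
  · simp [constrainedCost_of_notMem hx, hx]

variable [NormedAddCommGroup E] [InnerProductSpace ℝ E]

theorem mem_regularSubdiff_constrainedCost {f : E → ℝ} {g : E → F} {Θ : Set F} {x v : E} :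
    v ∈ regularSubdiff (constrainedCost f g Θ) x ↔
      g x ∈ Θ ∧ ∀ ε : ℝ, 0 < ε → ∀ᶠ u in 𝓝 x, g u ∈ Θ →
        f x + (inner ℝ v (u - x) - ε * ‖u - x‖) ≤ f u := by
  by_cases hx : g x ∈ Θ
  · simp only [regularSubdiff, Set.mem_ofPred_eq, constrainedCost_of_mem hx, hx, true_and]
    simp only [← EReal.coe_add, le_constrainedCost_iff]
    simp
  · simp [regularSubdiff, constrainedCost_of_notMem hx, hx]

theorem regularSubdiff_subset_limitingSubdiff (φ : E → EReal) (x : E) :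
    regularSubdiff φ x ⊆ limitingSubdiff φ x := fun v hv =>
  ⟨hv.1, hv.2.1, fun _ => x, fun _ => v, tendsto_const_nhds, tendsto_const_nhds,
    tendsto_const_nhds, fun _ => hv⟩

theorem mem_of_mem_limitingSubdiff_constrainedCost {f : E → ℝ} {g : E → F} {Θ : Set F} {x v : E}
    (hv : v ∈ limitingSubdiff (constrainedCost f g Θ) x) : g x ∈ Θ := by
  by_contra hx
  exact hv.1 (constrainedCost_of_notMem hx)

/-- The normal cone of convex analysis. -/
def convexNormalCone (Ω : Set E) (u : E) : Set E :=
  {y | u ∈ Ω ∧ ∀ z ∈ Ω, inner ℝ y (z - u) ≤ 0}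

theorem convexNormalCone_subset_normalCone (Ω : Set E) (u : E) :
    convexNormalCone Ω u ⊆ normalCone Ω u := by
  intro y hy
  rw [normalCone, ← constrainedCost_zero_id]
  refine regularSubdiff_subset_limitingSubdiff _ _ (mem_regularSubdiff_constrainedCost.2
    ⟨hy.1, fun ε hε => Eventually.of_forall fun z hz => ?_⟩)
  have h1 := hy.2 z hz
  have h2 : 0 ≤ ε * ‖z - u‖ := by positivity
  linarith

/-- This closed-graph property is what carries multipliers to limits. Membership of the limit point
is assumed because `Ω` need not be closed. -/
theorem mem_convexNormalCone_of_tendsto {Ω : Set E} {us ys : ℕ → E} {u y : E}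
    (hu : Tendsto us atTop (𝓝 u)) (hy : Tendsto ys atTop (𝓝 y)) (huΩ : u ∈ Ω)
    (h : ∀ k, ys k ∈ convexNormalCone Ω (us k)) : y ∈ convexNormalCone Ω u := by
  refine ⟨huΩ, fun z hz => ?_⟩
  exact le_of_tendsto (hy.inner (tendsto_const_nhds.sub hu))
    (Eventually.of_forall fun k => (h k).2 z hz)

theorem convex_convexNormalCone (Ω : Set E) (u : E) : Convex ℝ (convexNormalCone Ω u) := by
  intro y hy z hz a b ha hb _
  refine ⟨hy.1, fun w hw => ?_⟩
  rw [inner_add_left, real_inner_smul_left, real_inner_smul_left]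
  nlinarith [hy.2 w hw, hz.2 w hw]

theorem isClosed_convexNormalCone (Ω : Set E) (u : E) : IsClosed (convexNormalCone Ω u) := by
  by_cases hu : u ∈ Ω
  · have : convexNormalCone Ω u = ⋂ z ∈ Ω, {y | inner ℝ y (z - u) ≤ 0} := by
      ext y; simp [convexNormalCone, hu]
    rw [this]
    exact isClosed_biInter fun z _ => isClosed_le (by fun_prop) continuous_const
  · have : convexNormalCone Ω u = ∅ := by
      ext y; simp [convexNormalCone, hu]
    rw [this]
    exact isClosed_empty

/-- By convexity the segment from `xs k` to `z` stays in `Ω`. The regular inequality at a small step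
`t` on it, divided by `t`, gives the global inequality up to `ε`; the closed graph then covers
limiting normals. -/
theorem normalCone_subset_convexNormalCone {Ω : Set E} (hΩ : Convex ℝ Ω) (u : E) :
    normalCone Ω u ⊆ convexNormalCone Ω u := by
  intro y hy
  rw [normalCone, ← constrainedCost_zero_id] at hy
  obtain ⟨xs, vs, hxs, -, hvs, hreg⟩ := hy.2.2
  refine mem_convexNormalCone_of_tendsto hxs hvs
    (mem_of_mem_limitingSubdiff_constrainedCost hy) fun k => ?_
  obtain ⟨hmem, hk⟩ := mem_regularSubdiff_constrainedCost.1 (hreg k)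
  refine ⟨hmem, fun z hz => ?_⟩
  have key : ∀ ε : ℝ, 0 < ε → inner ℝ (vs k) (z - xs k) ≤ ε * ‖z - xs k‖ := by
    intro ε hε
    have hlim : Tendsto (fun t : ℝ => xs k + t • (z - xs k)) (𝓝[>] 0) (𝓝 (xs k)) := by
      have : Continuous fun t : ℝ => xs k + t • (z - xs k) := by fun_prop
      simpa using (this.tendsto 0).mono_left nhdsWithin_le_nhds
    have hev := hlim.eventually (hk ε hε)
    have h01 : ∀ᶠ t : ℝ in 𝓝[>] 0, t ∈ Set.Ioc (0 : ℝ) 1 :=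
      Ioc_mem_nhdsGT one_pos
    obtain ⟨t, ht, h0, h1⟩ := (hev.and h01).exists
    have hin : xs k + t • (z - xs k) ∈ Ω := hΩ.add_smul_sub_mem hmem hz ⟨h0.le, h1⟩
    have := ht hin
    simp only [add_sub_cancel_left, inner_smul_right, norm_smul, Real.norm_eq_abs,
      abs_of_pos h0] at this
    have : t * inner ℝ (vs k) (z - xs k) ≤ t * (ε * ‖z - xs k‖) := by linarith
    exact le_of_mul_le_mul_left this h0
  have hl : Tendsto (fun ε : ℝ => ε * ‖z - xs k‖) (𝓝[>] 0) (𝓝 0) := by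
    have : Continuous fun ε : ℝ => ε * ‖z - xs k‖ := by fun_prop
    simpa using (this.tendsto 0).mono_left nhdsWithin_le_nhds
  exact ge_of_tendsto hl (by filter_upwards [self_mem_nhdsWithin] with ε hε using key ε hε)

theorem IsConvexPolyhedron.convex {Θ : Set E} (h : IsConvexPolyhedron Θ) : Convex ℝ Θ := by
  obtain ⟨p, a, b, rfl⟩ := h
  rw [Set.ofPred_forall]
  exact convex_iInter fun i => convex_halfSpace_le (innerₛₗ ℝ (a i)).isLinear (b i)

theorem IsConvexPolyhedron.isClosed {Θ : Set E} (h : IsConvexPolyhedron Θ) : IsClosed Θ := by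
  obtain ⟨p, a, b, rfl⟩ := h
  rw [Set.ofPred_forall]
  exact isClosed_iInter fun i => isClosed_le (by fun_prop) continuous_const

/-- Limiting subgradients of a proper convex function are subgradients of convex analysis. -/
theorem ConvexOnWithModulus.le_of_mem_limitingSubdiff {ψ : E → EReal}
    (hψ : ConvexOnWithModulus Set.univ 0 ψ) (hbot : ∀ x, ψ x ≠ ⊥) {x v : E}
    (hv : v ∈ limitingSubdiff ψ x) (u : E) :
    ψ x + ((inner ℝ v (u - x) : ℝ) : EReal) ≤ ψ u := by
  by_cases hu : ψ u = ⊤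
  · simp [hu]
  obtain ⟨hx, hx', xs, vs, hxs, hψxs, hvs, hreg⟩ := hv
  have key : ∀ k, (ψ (xs k)).toReal + inner ℝ (vs k) (u - xs k) ≤ (ψ u).toReal := by
    intro k
    obtain ⟨h1, h2, h3⟩ := hreg k
    set c := (ψ (xs k)).toReal with hc
    set d := (ψ u).toReal with hd
    have hc' : ψ (xs k) = (c : EReal) := (EReal.coe_toReal h1 h2).symm
    have hd' : ψ u = (d : EReal) := (EReal.coe_toReal hu (hbot u)).symm
    have key : ∀ ε : ℝ, 0 < ε → c + inner ℝ (vs k) (u - xs k) - d ≤ ε * ‖u - xs k‖ := by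
      intro ε hε
      have hlim : Tendsto (fun t : ℝ => xs k + t • (u - xs k)) (𝓝[>] 0) (𝓝 (xs k)) := by
        have : Continuous fun t : ℝ => xs k + t • (u - xs k) := by fun_prop
        simpa using (this.tendsto 0).mono_left nhdsWithin_le_nhds
      have hev := hlim.eventually (h3 ε hε)
      have h01 : ∀ᶠ t : ℝ in 𝓝[>] 0, t ∈ Set.Ioo (0 : ℝ) 1 :=
        Ioo_mem_nhdsGT one_pos
      obtain ⟨t, ht, h0, h1⟩ := (hev.and h01).exists
      have hcv := hψ (xs k) trivial u trivial (1 - t) t (by linarith) h0 (by ring)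
      have heq : (1 - t) • xs k + t • u = xs k + t • (u - xs k) := by module
      rw [heq, hc', hd'] at hcv
      rw [hc'] at ht
      simp only [zero_div, zero_mul, mul_zero, EReal.coe_zero, add_zero] at hcv
      have := ht.trans hcv
      norm_cast at this
      simp only [add_sub_cancel_left, inner_smul_right, norm_smul, Real.norm_eq_abs,
        abs_of_pos h0] at this
      have : t * (c + inner ℝ (vs k) (u - xs k) - d) ≤ t * (ε * ‖u - xs k‖) := by linarith
      exact le_of_mul_le_mul_left this h0
    have hl : Tendsto (fun ε : ℝ => ε * ‖u - xs k‖) (𝓝[>] 0) (𝓝 0) := by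
      have : Continuous fun ε : ℝ => ε * ‖u - xs k‖ := by fun_prop
      simpa using (this.tendsto 0).mono_left nhdsWithin_le_nhds
    have := ge_of_tendsto hl (by filter_upwards [self_mem_nhdsWithin] with ε hε using key ε hε)
    linarith
  have hlim : Tendsto (fun k => (ψ (xs k)).toReal + inner ℝ (vs k) (u - xs k)) atTop
      (𝓝 ((ψ x).toReal + inner ℝ v (u - x))) :=
    ((EReal.tendsto_toReal hx hx').comp hψxs).add (hvs.inner (tendsto_const_nhds.sub hxs))
  have := le_of_tendsto hlim (Eventually.of_forall key)
  rw [← EReal.coe_toReal hx hx', ← EReal.coe_toReal hu (hbot u)]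
  exact_mod_cast this

end Normals

theorem tendsto_inv_smul_sub {E F : Type*} [NormedAddCommGroup E] [NormedSpace ℝ E]
    [NormedAddCommGroup F] [NormedSpace ℝ F] {G : E → F} {x w : E} (hG : DifferentiableAt ℝ G x) {t : ℕ → ℝ}
    {ws : ℕ → E} (ht : ∀ k, 0 < t k) (htlim : Tendsto t atTop (𝓝 0))
    (hw : Tendsto ws atTop (𝓝 w)) :
    Tendsto (fun k => (t k)⁻¹ • (G (x + t k • ws k) - G x)) atTop (𝓝 (fderiv ℝ G x w)) := by
  refine hG.hasFDerivAt.hasFDerivWithinAt.lim (s := Set.univ)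
    (by simpa using htlim.smul hw) (by simp) ?_
  refine hw.congr fun k => ?_
  rw [smul_smul, inv_mul_cancel₀ (ht k).ne', one_smul]

/-! ### Multipliers for normals to the feasible set under metric subregularity. -/

section Multipliers

variable {E F : Type*} [NormedAddCommGroup E] [InnerProductSpace ℝ E]
  [NormedAddCommGroup F] [InnerProductSpace ℝ F] [FiniteDimensional ℝ F]

/-- The distance to a closed convex set is realized by a normal of norm at most one at the
projection. -/
theorem exists_normal_of_infDist {Ω : Set F} (hΩ : Convex ℝ Ω) (hcl : IsClosed Ω)
    (hne : Ω.Nonempty) (z : F) :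
    ∃ p n : F, n ∈ convexNormalCone Ω p ∧ ‖n‖ ≤ 1 ∧ dist z p = Metric.infDist z Ω ∧
      inner ℝ n (z - p) = Metric.infDist z Ω := by
  obtain ⟨p, hp, hd⟩ := hcl.exists_infDist_eq_dist hne z
  have hnorm : ‖z - p‖ = ⨅ w : Ω, ‖z - w‖ := by
    rw [← dist_eq_norm, ← hd, Metric.infDist_eq_iInf]
    simp only [dist_eq_norm]
  have hin := (norm_eq_iInf_iff_real_inner_le_zero hΩ hp).1 hnorm
  -- If `z ∈ Ω`, then `p = z` and `0⁻¹ = 0` makes this normal zero; hence norm at most one rather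
  -- than equal to one.
  refine ⟨p, ‖z - p‖⁻¹ • (z - p), ⟨hp, fun w hw => ?_⟩, ?_, hd.symm, ?_⟩
  · rw [real_inner_smul_left]
    exact mul_nonpos_of_nonneg_of_nonpos (by positivity) (hin w hw)
  · rw [norm_smul, norm_inv, norm_norm]
    exact inv_mul_le_one
  · rw [real_inner_smul_left, real_inner_self_eq_norm_sq, hd, dist_eq_norm]
    by_cases h : ‖z - p‖ = 0
    · simp [h]
    · field_simp

/-- This is the dual estimate in one direction `h`. By subregularity `x + t h` is within `κ dist(g(x
+ t h); Θ)` of `Γ`, and that distance is at most `⟨n, g(x + t h) - g(x)⟩` for a normal `n` at the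
projection onto `Θ`. As `v` is a regular normal, moving from `x` to a nearby feasible point gains
only `o(t)`. Divide by `t` and pass to a limit of the normals. -/
theorem exists_normal_of_regularNormal {g : E → F} {Θ : Set F} (hΘ : Convex ℝ Θ)
    (hcl : IsClosed Θ) {x v : E} {κ : ℝ} (hκ : 0 < κ) (hg : DifferentiableAt ℝ g x)
    (hx : g x ∈ Θ)
    (hsub : ∀ᶠ u in 𝓝 x, Metric.infDist u (feasibleSet g Θ) ≤ κ * Metric.infDist (g u) Θ)
    (hv : ∀ ε : ℝ, 0 < ε → ∀ᶠ u in 𝓝 x, g u ∈ Θ → inner ℝ v (u - x) ≤ ε * ‖u - x‖) (h : E) :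
    ∃ n ∈ convexNormalCone Θ (g x), ‖n‖ ≤ 1 ∧
      inner ℝ v h ≤ κ * ‖v‖ * inner ℝ n (fderiv ℝ g x h) := by
  set t : ℕ → ℝ := fun k => 1 / ((k : ℝ) + 1) with ht
  have htpos : ∀ k, 0 < t k := fun k => by positivity
  have ht1 : ∀ k, t k ≤ 1 := fun k => by
    rw [ht]; simp only; rw [div_le_one (by positivity)]; linarith [(Nat.cast_nonneg k : (0:ℝ) ≤ k)]
  have htlim : Tendsto t atTop (𝓝 0) := tendsto_one_div_add_atTop_nhds_zero_nat
  have hdlim : Tendsto (fun k => t k • h) atTop (𝓝 0) := by simpa using htlim.smul_const h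
  have hxlim : Tendsto (fun k => x + t k • h) atTop (𝓝 x) := by
    simpa using tendsto_const_nhds.add hdlim
  have hquot := tendsto_inv_smul_sub hg htpos htlim (tendsto_const_nhds (x := h))
  choose p n hn hn1 hpd hnd using fun k =>
    exists_normal_of_infDist hΘ hcl ⟨_, hx⟩ (g (x + t k • h))
  obtain ⟨n₀, -, φ, hφ, hφlim⟩ := tendsto_subseq_of_bounded
    (Metric.isBounded_closedBall (x := (0 : F)) (r := 1)) (x := n)
    (fun k => by simpa using hn1 k)
  have hglim : Tendsto (fun k => g (x + t k • h)) atTop (𝓝 (g x)) :=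
    hg.continuousAt.tendsto.comp hxlim
  have hplim : Tendsto p atTop (𝓝 (g x)) := by
    have h0 : Tendsto (fun k => dist (g (x + t k • h)) (p k)) atTop (𝓝 0) := by
      refine squeeze_zero (fun k => dist_nonneg) (fun k => ?_)
        (tendsto_iff_dist_tendsto_zero.1 hglim)
      rw [hpd]
      exact Metric.infDist_le_dist_of_mem hx
    exact (tendsto_iff_of_dist h0).1 hglim
  have hin : ∀ k, Metric.infDist (g (x + t k • h)) Θ ≤ inner ℝ (n k) (g (x + t k • h) - g x) := by
    intro k
    have h1 := (hn k).2 _ hx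
    have h2 : inner ℝ (n k) (g (x + t k • h) - g x) =
        inner ℝ (n k) (g (x + t k • h) - p k) - inner ℝ (n k) (g x - p k) := by
      rw [← inner_sub_right]; congr 1; abel
    linarith [hnd k]
  refine ⟨n₀, mem_convexNormalCone_of_tendsto (hplim.comp hφ.tendsto_atTop) hφlim hx
    fun k => hn _, ?_, ?_⟩
  · exact le_of_tendsto hφlim.norm (Eventually.of_forall fun k => hn1 _)
  have hne : (feasibleSet g Θ).Nonempty := ⟨x, hx⟩
  -- Near-projections are used because `Γ` is not known to be closed; the extra error `t k ^ 2`
  -- disappears after division by `t k`.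
  have hclose : ∀ k, ∃ u ∈ feasibleSet g Θ, dist (x + t k • h) u <
      Metric.infDist (x + t k • h) (feasibleSet g Θ) + t k ^ 2 := fun k =>
    (Metric.infDist_lt_iff hne).1 (by have := htpos k; nlinarith [sq_pos_of_pos this])
  choose u hu hud using hclose
  have hux : ∀ k, ‖u k - x‖ ≤ (2 * ‖h‖ + 1) * t k := by
    intro k
    have h1 : Metric.infDist (x + t k • h) (feasibleSet g Θ) ≤ t k * ‖h‖ := by
      refine (Metric.infDist_le_dist_of_mem (show x ∈ feasibleSet g Θ from hx)).trans ?_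
      simp [dist_eq_norm, norm_smul, abs_of_pos (htpos k)]
    have h2 : ‖u k - x‖ ≤ dist (x + t k • h) (u k) + t k * ‖h‖ := by
      have : u k - x = -((x + t k • h) - u k) + t k • h := by abel
      rw [this, dist_eq_norm]
      refine (norm_add_le _ _).trans ?_
      rw [norm_neg, norm_smul, Real.norm_eq_abs, abs_of_pos (htpos k)]
    nlinarith [hud k, htpos k, ht1 k]
  have hulim : Tendsto u atTop (𝓝 x) := by
    rw [tendsto_iff_norm_sub_tendsto_zero]
    exact squeeze_zero (fun k => norm_nonneg _) hux (by simpa using htlim.const_mul _)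
  have key : ∀ ε : ℝ, 0 < ε →
      inner ℝ v h - κ * ‖v‖ * inner ℝ n₀ (fderiv ℝ g x h) ≤ ε * (2 * ‖h‖ + 1) := by
    intro ε hε
    have hev : ∀ᶠ k in atTop, inner ℝ v h ≤ κ * ‖v‖ *
        inner ℝ (n k) ((t k)⁻¹ • (g (x + t k • h) - g x)) + ‖v‖ * t k + ε * (2 * ‖h‖ + 1) := by
      filter_upwards [hxlim.eventually hsub, hulim.eventually (hv ε hε)] with k h1 h2
      have h3 := (h2 (hu k)).trans (mul_le_mul_of_nonneg_left (hux k) hε.le)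
      have h4 : inner ℝ v (x + t k • h - u k) ≤ ‖v‖ * dist (x + t k • h) (u k) := by
        rw [dist_eq_norm]; exact real_inner_le_norm _ _
      have h5 : ‖v‖ * dist (x + t k • h) (u k) ≤
          ‖v‖ * (κ * inner ℝ (n k) (g (x + t k • h) - g x) + t k ^ 2) := by
        refine mul_le_mul_of_nonneg_left ?_ (norm_nonneg _)
        nlinarith [hud k, hin k]
      have h6 : t k * inner ℝ v h = inner ℝ v (x + t k • h - u k) + inner ℝ v (u k - x) := by
        rw [← inner_add_right, ← real_inner_smul_right]; congr 1; abel
      rw [real_inner_smul_right]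
      refine le_of_mul_le_mul_left ?_ (htpos k)
      have h7 : t k * (κ * ‖v‖ * ((t k)⁻¹ * inner ℝ (n k) (g (x + t k • h) - g x)) + ‖v‖ * t k +
          ε * (2 * ‖h‖ + 1)) = ‖v‖ * (κ * inner ℝ (n k) (g (x + t k • h) - g x) + t k ^ 2) +
          ε * ((2 * ‖h‖ + 1) * t k) := by
        have := (htpos k).ne'
        field_simp
      linarith
    have hlim : Tendsto (fun k => κ * ‖v‖ *
        inner ℝ (n (φ k)) ((t (φ k))⁻¹ • (g (x + t (φ k) • h) - g x)) + ‖v‖ * t (φ k) +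
          ε * (2 * ‖h‖ + 1)) atTop
        (𝓝 (κ * ‖v‖ * inner ℝ n₀ (fderiv ℝ g x h) + ‖v‖ * 0 + ε * (2 * ‖h‖ + 1))) :=
      (((hφlim.inner (hquot.comp hφ.tendsto_atTop)).const_mul _).add
        ((htlim.comp hφ.tendsto_atTop).const_mul _)).add_const _
    have := ge_of_tendsto hlim (hφ.tendsto_atTop.eventually hev)
    linarith
  have hl : Tendsto (fun ε : ℝ => ε * (2 * ‖h‖ + 1)) (𝓝[>] 0) (𝓝 0) := by
    have : Continuous fun ε : ℝ => ε * (2 * ‖h‖ + 1) := by fun_prop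
    simpa using (this.tendsto 0).mono_left nhdsWithin_le_nhds
  have := ge_of_tendsto hl (by filter_upwards [self_mem_nhdsWithin] with ε hε using key ε hε)
  linarith

variable [FiniteDimensional ℝ E]

/-- Under metric subregularity, regular normals to `g ⁻¹' Θ` have multipliers of controlled
norm. -/
theorem exists_multiplier_of_regularNormal {g : E → F} {Θ : Set F} (hΘ : Convex ℝ Θ)
    (hcl : IsClosed Θ) {x v : E} {κ : ℝ} (hκ : 0 < κ) (hg : DifferentiableAt ℝ g x)
    (hx : g x ∈ Θ)
    (hsub : ∀ᶠ u in 𝓝 x, Metric.infDist u (feasibleSet g Θ) ≤ κ * Metric.infDist (g u) Θ)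
    (hv : ∀ ε : ℝ, 0 < ε → ∀ᶠ u in 𝓝 x, g u ∈ Θ → inner ℝ v (u - x) ≤ ε * ‖u - x‖) :
    ∃ y ∈ convexNormalCone Θ (g x), ‖y‖ ≤ κ * ‖v‖ ∧ (fderiv ℝ g x).adjoint y = v := by
  set A := fderiv ℝ g x with hA
  set D : Set F := convexNormalCone Θ (g x) ∩ Metric.closedBall 0 (κ * ‖v‖) with hD
  have hDc : Convex ℝ D := (convex_convexNormalCone _ _).inter (convex_closedBall _ _)
  have hDk : IsCompact D :=
    (isCompact_closedBall _ _).inter_left (isClosed_convexNormalCone _ _)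
  by_cases hmem : v ∈ A.adjoint '' D
  · obtain ⟨y, ⟨hy, hy'⟩, h⟩ := hmem
    exact ⟨y, hy, by simpa using hy', h⟩
  exfalso
  -- The image of the compact convex set `D` is closed and convex, so `v` is strictly separated from
  -- it by some `h`. The one-direction estimate for this `h` yields `κ‖v‖ n ∈ D`, which violates the
  -- separation.
  obtain ⟨ℓ, c, h1, h2⟩ := geometric_hahn_banach_closed_point
    (hDc.linear_image (A.adjoint : F →ₗ[ℝ] E)) (hDk.image A.adjoint.continuous).isClosed hmem
  set h := (InnerProductSpace.toDual ℝ E).symm ℓ with hh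
  have hℓ : ∀ w, ℓ w = inner ℝ w h := fun w => by
    rw [real_inner_comm, hh, InnerProductSpace.toDual_symm_apply]
  obtain ⟨n, hn, hn1, hle⟩ := exists_normal_of_regularNormal hΘ hcl hκ hg hx hsub hv h
  have hκv : 0 ≤ κ * ‖v‖ := by positivity
  have hin : (κ * ‖v‖) • n ∈ D := by
    refine ⟨⟨hx, fun z hz => ?_⟩, ?_⟩
    · rw [real_inner_smul_left]
      exact mul_nonpos_of_nonneg_of_nonpos hκv (hn.2 z hz)
    · rw [mem_closedBall_zero_iff, norm_smul, Real.norm_eq_abs, abs_of_nonneg hκv]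
      exact mul_le_of_le_one_right hκv hn1
  have h3 := h1 _ (Set.mem_image_of_mem _ hin)
  rw [hℓ] at h2 h3
  simp only [ContinuousLinearMap.coe_coe, ContinuousLinearMap.adjoint_inner_left,
    real_inner_smul_left] at h3
  linarith

end Multipliers

/-! ### Second-order expansion along the graph of the subdifferential. -/

section SecondOrder

variable {E F : Type*} [NormedAddCommGroup E] [InnerProductSpace ℝ E]
  [NormedAddCommGroup F] [InnerProductSpace ℝ F]

theorem ContDiffAt.exists_taylor_bound {h : E → F} {x₀ : E} (hh : ContDiffAt ℝ 2 h x₀) :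
    ∃ L : ℝ, 0 ≤ L ∧ ∃ ρ : ℝ, 0 < ρ ∧ ∀ x ∈ Metric.ball x₀ ρ, ∀ u ∈ Metric.ball x₀ ρ,
      ‖h u - h x - fderiv ℝ h x (u - x)‖ ≤ L * ‖u - x‖ ^ 2 := by
  obtain ⟨K, s, hs, hK⟩ := (hh.fderiv_right (m := 1) le_rfl).exists_lipschitzOnWith
  have hdiff : ∀ᶠ x in 𝓝 x₀, DifferentiableAt ℝ h x :=
    (hh.eventually (by simp)).mono fun x hx => hx.differentiableAt (by simp)
  obtain ⟨ρ, hρ, hball⟩ := Metric.eventually_nhds_iff_ball.1 (hdiff.and hs)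
  refine ⟨K, K.2, ρ, hρ, fun x hx u hu => ?_⟩
  have hseg : segment ℝ x u ⊆ Metric.ball x₀ ρ := (convex_ball x₀ ρ).segment_subset hx hu
  have := (convex_segment x u).norm_image_sub_le_of_norm_hasFDerivWithin_le'
    (f := h) (f' := fderiv ℝ h) (φ := fderiv ℝ h x) (C := K * ‖u - x‖)
    (fun z hz => (hball z (hseg hz)).1.hasFDerivAt.hasFDerivWithinAt) (fun z hz => ?_)
    (left_mem_segment ℝ x u) (right_mem_segment ℝ x u)
  · rw [pow_two, ← mul_assoc]; exact this
  · have h1 := hK.dist_le_mul z (hball z (hseg hz)).2 x (hball x hx).2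
    rw [dist_eq_norm, dist_eq_norm] at h1
    refine h1.trans (mul_le_mul_of_nonneg_left ?_ K.2)
    exact norm_sub_le_of_mem_segment hz

theorem tendsto_continuousLinearMap_apply {Bs : ℕ → F →L[ℝ] E} {B : F →L[ℝ] E} {ys : ℕ → F}
    {y : F} (hB : Tendsto Bs atTop (𝓝 B)) (hy : Tendsto ys atTop (𝓝 y)) :
    Tendsto (fun k => Bs k (ys k)) atTop (𝓝 (B y)) := by
  have h : Continuous fun p : (F →L[ℝ] E) × F => p.1 p.2 := isBoundedBilinearMap_apply.continuous
  exact (h.tendsto (B, y)).comp (hB.prodMk_nhds hy)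

variable [FiniteDimensional ℝ E] [FiniteDimensional ℝ F]

theorem gradient_inner_comp {g : E → F} {z : E} (hg : DifferentiableAt ℝ g z) (y : F) :
    gradient (fun z => (inner ℝ y (g z) : ℝ)) z = (fderiv ℝ g z).adjoint y := by
  refine ext_inner_right ℝ fun w => ?_
  rw [inner_gradient_left, ContinuousLinearMap.adjoint_inner_left]
  have := (HasFDerivAt.inner ℝ (hasFDerivAt_const y z) hg.hasFDerivAt).fderiv
  rw [this]
  simp [fderivInnerCLM_apply]

theorem ContDiffAt.differentiableAt_gradient {h : E → ℝ} {x : E} (hh : ContDiffAt ℝ 2 h x) :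
    DifferentiableAt ℝ (gradient h) x := by
  have h1 : DifferentiableAt ℝ (fderiv ℝ h) x :=
    (hh.fderiv_right (m := 1) le_rfl).differentiableAt (by simp)
  let D : StrongDual ℝ E →ₗ[ℝ] E :=
    { toFun := (InnerProductSpace.toDual ℝ E).symm
      map_add' := map_add _
      map_smul' := fun c ℓ => by simp }
  exact ((LinearMap.toContinuousLinearMap D).differentiableAt (x := fderiv ℝ h x)).comp x h1

theorem tendsto_hessianForm {h : E → ℝ} {x w : E} (hh : ContDiffAt ℝ 2 h x) {t : ℕ → ℝ}
    {ws : ℕ → E} (ht : ∀ k, 0 < t k) (htlim : Tendsto t atTop (𝓝 0))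
    (hw : Tendsto ws atTop (𝓝 w)) :
    Tendsto (fun k => (t k)⁻¹ * inner ℝ (gradient h (x + t k • ws k) - gradient h x) (ws k)) atTop
      (𝓝 (hessianForm h x w)) := by
  have := (tendsto_inv_smul_sub (ContDiffAt.differentiableAt_gradient hh) ht htlim hw).inner (𝕜 := ℝ) hw
  simpa only [real_inner_smul_left, hessianForm] using this

/-- Subtract the two multiplier equations and pair with `ws k`. Besides the gradient increments that
produce the Hessian forms, there remains `⟨y_k - y, ∇g(x_k) w_k⟩`. Up to a Taylor remainder, `t_k`
times it is `⟨y_k, g(x_k) - g(x)⟩ - ⟨y, g(x_k) - g(x)⟩`, which is nonnegative since `y_k` and `y`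
are normals at `g(x_k)` and `g(x)`. The same two signs, in the limit, force `⟨y, ∇g(x) w⟩ = 0`,
which is criticality of `w`. -/
theorem hessianForm_le_of_tendsto {f : E → ℝ} {g : E → F} {Θ : Set F} {x v w q : E} {y : F}
    (hf : ContDiffAt ℝ 2 f x) (hg : ContDiffAt ℝ 2 g x) (hx : g x ∈ Θ) {t : ℕ → ℝ}
    {ws qs : ℕ → E} {ys : ℕ → F} (ht : ∀ k, 0 < t k) (htlim : Tendsto t atTop (𝓝 0))
    (hw : Tendsto ws atTop (𝓝 w)) (hq : Tendsto qs atTop (𝓝 q)) (hy : Tendsto ys atTop (𝓝 y))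
    (hN : ∀ k, ys k ∈ convexNormalCone Θ (g (x + t k • ws k)))
    (hv : ∀ k, v + t k • qs k = gradient f (x + t k • ws k) +
      (fderiv ℝ g (x + t k • ws k)).adjoint (ys k)) :
    y ∈ convexNormalCone Θ (g x) ∧ v = gradient f x + (fderiv ℝ g x).adjoint y ∧
      w ∈ criticalCone (feasibleSet g Θ) x (v - gradient f x) ∧
      hessianForm f x w + hessianForm (fun z => inner ℝ y (g z)) x w ≤ inner ℝ q w := by
  have hdlim : Tendsto (fun k => t k • ws k) atTop (𝓝 0) := by simpa using htlim.smul hw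
  have hxlim : Tendsto (fun k => x + t k • ws k) atTop (𝓝 x) := by
    simpa using tendsto_const_nhds.add hdlim
  have hgd : DifferentiableAt ℝ g x := hg.differentiableAt (by simp)
  have hyN : y ∈ convexNormalCone Θ (g x) :=
    mem_convexNormalCone_of_tendsto (hgd.continuousAt.tendsto.comp hxlim) hy hx hN
  have hAlim : Tendsto (fun k => (fderiv ℝ g (x + t k • ws k)).adjoint (ys k)) atTop
      (𝓝 ((fderiv ℝ g x).adjoint y)) := by
    have h1 : ContinuousAt (fderiv ℝ g) x := (hg.fderiv_right (m := 1) le_rfl).continuousAt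
    have h2 : Tendsto (fun k => (fderiv ℝ g (x + t k • ws k)).adjoint) atTop
        (𝓝 (fderiv ℝ g x).adjoint) :=
      (ContinuousLinearMap.adjoint.continuous.tendsto _).comp (h1.tendsto.comp hxlim)
    exact tendsto_continuousLinearMap_apply h2 hy
  have hveq : v = gradient f x + (fderiv ℝ g x).adjoint y := by
    have h1 : Tendsto (fun k => v + t k • qs k) atTop (𝓝 v) := by
      simpa using tendsto_const_nhds.add (htlim.smul hq)
    have h2 := ((ContDiffAt.differentiableAt_gradient hf).continuousAt.tendsto.comp hxlim).add hAlim
    exact tendsto_nhds_unique h1 (h2.congr fun k => (hv k).symm)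
  have hquot := tendsto_inv_smul_sub hgd ht htlim hw
  have hnonneg : ∀ k, 0 ≤ inner ℝ (ys k) (g (x + t k • ws k) - g x) := fun k => by
    have := (hN k).2 _ hx
    rw [← neg_sub, inner_neg_right] at this
    linarith
  have hnonpos : ∀ k, inner ℝ y (g (x + t k • ws k) - g x) ≤ 0 := fun k =>
    hyN.2 _ (hN k).1
  refine ⟨hyN, hveq, ⟨⟨t, ws, ht, htlim, hw, fun k => (hN k).1⟩, ?_⟩, ?_⟩
  · have h0 : inner ℝ (v - gradient f x) w = inner ℝ y (fderiv ℝ g x w) := by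
      rw [hveq, add_sub_cancel_left, ContinuousLinearMap.adjoint_inner_left]
    rw [h0]
    refine le_antisymm ?_ ?_
    · refine le_of_tendsto (tendsto_const_nhds.inner hquot) (Eventually.of_forall fun k => ?_)
      rw [real_inner_smul_right]
      exact mul_nonpos_of_nonneg_of_nonpos (inv_nonneg.2 (ht k).le) (hnonpos k)
    · refine ge_of_tendsto (hy.inner hquot) (Eventually.of_forall fun k => ?_)
      rw [real_inner_smul_right]
      exact mul_nonneg (inv_nonneg.2 (ht k).le) (hnonneg k)
  · obtain ⟨L, hL, ρ, hρ, hT⟩ := ContDiffAt.exists_taylor_bound hg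
    have hH : ContDiffAt ℝ 2 (fun z => (inner ℝ y (g z) : ℝ)) x := contDiffAt_const.inner ℝ hg
    have hev : ∀ᶠ k in atTop,
        (t k)⁻¹ * inner ℝ (gradient f (x + t k • ws k) - gradient f x) (ws k) +
        (t k)⁻¹ * inner ℝ (gradient (fun z => (inner ℝ y (g z) : ℝ)) (x + t k • ws k) -
          gradient (fun z => (inner ℝ y (g z) : ℝ)) x) (ws k) -
        ‖ys k - y‖ * (L * ‖ws k‖ ^ 2) ≤ inner ℝ (qs k) (ws k) := by
      have hd : ∀ᶠ z in 𝓝 x, DifferentiableAt ℝ g z :=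
        (hg.eventually (by simp)).mono fun z hz => hz.differentiableAt (by simp)
      filter_upwards [hxlim.eventually hd, hxlim.eventually (Metric.ball_mem_nhds x hρ)] with k h1 h2
      rw [gradient_inner_comp h1, gradient_inner_comp hgd]
      have hT' := hT _ h2 x (Metric.mem_ball_self hρ)
      set xk := x + t k • ws k with hxk
      have e1 : x - xk = -(t k • ws k) := by rw [hxk]; abel
      -- The expansion is centred at `xk` because `ys k` is paired with the derivative there.
      set R := g x - g xk - fderiv ℝ g xk (x - xk) with hR
      have e2 : t k • fderiv ℝ g xk (ws k) = g xk - g x + R := by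
        rw [hR, e1, map_neg, map_smul]; abel
      have e3 : ‖x - xk‖ ^ 2 = t k ^ 2 * ‖ws k‖ ^ 2 := by
        rw [e1, norm_neg, norm_smul, Real.norm_eq_abs, abs_of_pos (ht k), mul_pow]
      rw [e3] at hT'
      have e4 : t k * inner ℝ (qs k) (ws k) = inner ℝ (gradient f xk - gradient f x) (ws k) +
          inner ℝ ((fderiv ℝ g xk).adjoint y - (fderiv ℝ g x).adjoint y) (ws k) +
          inner ℝ (ys k - y) (fderiv ℝ g xk (ws k)) := by
        rw [← real_inner_smul_left, ← ContinuousLinearMap.adjoint_inner_left, ← inner_add_left,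
          ← inner_add_left, map_sub]
        congr 1
        have := hv k
        rw [hveq] at this
        rw [← sub_eq_zero] at this ⊢
        rw [← this]; abel
      have e5 : t k * inner ℝ (ys k - y) (fderiv ℝ g xk (ws k)) =
          inner ℝ (ys k) (g xk - g x) - inner ℝ y (g xk - g x) + inner ℝ (ys k - y) R := by
        rw [← real_inner_smul_right, e2, inner_add_right, inner_sub_left]
      -- The remainder `R` is only `O(t k ^ 2)`; it is negligible at second order because it is
      -- paired with `ys k - y`, which tends to zero.
      have e6 : -(‖ys k - y‖ * (L * (t k ^ 2 * ‖ws k‖ ^ 2))) ≤ inner ℝ (ys k - y) R := by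
        have := (abs_le.1 (abs_real_inner_le_norm (ys k - y) R)).1
        have h5 := mul_le_mul_of_nonneg_left hT' (norm_nonneg (ys k - y))
        linarith
      have e7 : -(‖ys k - y‖ * (L * ‖ws k‖ ^ 2)) * t k ≤
          inner ℝ (ys k - y) (fderiv ℝ g xk (ws k)) := by
        refine le_of_mul_le_mul_left ?_ (ht k)
        rw [e5]
        nlinarith [hnonneg k, hnonpos k]
      refine le_of_mul_le_mul_left ?_ (ht k)
      rw [e4, mul_sub, mul_add, mul_inv_cancel_left₀ (ht k).ne', mul_inv_cancel_left₀ (ht k).ne']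
      linarith
    have hlim := ((tendsto_hessianForm hf ht htlim hw).add
      (tendsto_hessianForm hH ht htlim hw)).sub
      (((tendsto_iff_norm_sub_tendsto_zero.1 hy)).mul (((hw.norm.pow 2).const_mul L)))
    have := le_of_tendsto_of_tendsto hlim (hq.inner hw) hev
    simpa using this

/-- Second-order lower bound for the graphical derivative of `∂(f + δ_Γ)`. -/
theorem SecondOrderCondition.le_inner {f : E → ℝ} {g : E → F} {Θ : Set F} {σ : ℝ} {U V : Set E}
    (hsoc : ∀ x ∈ U, ∀ v ∈ V,
      ∀ w : E, -w ∈ criticalCone (feasibleSet g Θ) x (v - gradient f x) →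
      ∀ y ∈ multiplierSet f g Θ x v,
        σ * ‖w‖ ^ 2 ≤ hessianForm f x w + hessianForm (fun z => inner ℝ y (g z)) x w)
    {x v w q : E} (hxU : x ∈ U) (hvV : v ∈ V)
    (hf : ContDiffAt ℝ 2 f x) (hg : ContDiffAt ℝ 2 g x) (hx : g x ∈ Θ) {C : ℝ} {t : ℕ → ℝ}
    {ws qs : ℕ → E} (ht : ∀ k, 0 < t k) (htlim : Tendsto t atTop (𝓝 0))
    (hw : Tendsto ws atTop (𝓝 w)) (hq : Tendsto qs atTop (𝓝 q))
    (hmul : ∀ k, ∃ y ∈ convexNormalCone Θ (g (x + t k • ws k)), ‖y‖ ≤ C ∧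
      v + t k • qs k = gradient f (x + t k • ws k) +
        (fderiv ℝ g (x + t k • ws k)).adjoint y) :
    σ * ‖w‖ ^ 2 ≤ inner ℝ q w := by
  choose ys hN hC hv using hmul
  obtain ⟨y, -, φ, hφ, hy⟩ := tendsto_subseq_of_bounded
    (Metric.isBounded_closedBall (x := (0 : F)) (r := C)) (x := ys) (fun k => by simpa using hC k)
  have hφ' := hφ.tendsto_atTop
  obtain ⟨h1, h2, h3, h4⟩ := hessianForm_le_of_tendsto hf hg hx (fun k => ht (φ k))
    (htlim.comp hφ') (hw.comp hφ') (hq.comp hφ') hy (fun k => hN (φ k)) (fun k => hv (φ k))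
  -- The condition is stated for `-w` critical; both sides are even in `w`, so the sign is harmless.
  have h5 := hsoc x hxU v hvV (-w) (by simpa using h3) y
    ⟨h2, convexNormalCone_subset_normalCone _ _ h1⟩
  simp only [hessianForm, map_neg, inner_neg_neg, norm_neg] at h4 h5
  linarith

end SecondOrder

/-! ### Bounded multipliers and prox-regularity near the reference point. -/

section LocalData

variable {E F : Type*} [NormedAddCommGroup E] [InnerProductSpace ℝ E] [FiniteDimensional ℝ E]

theorem eventually_inner_le_of_mem_regularSubdiff {f : E → ℝ} {g : E → F} {Θ : Set F} {x v : E}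
    (hf : DifferentiableAt ℝ f x) (hv : v ∈ regularSubdiff (constrainedCost f g Θ) x) (ε : ℝ)
    (hε : 0 < ε) : ∀ᶠ u in 𝓝 x, g u ∈ Θ → inner ℝ (v - gradient f x) (u - x) ≤ ε * ‖u - x‖ := by
  have h1 := hf.hasFDerivAt.isLittleO.def (half_pos hε)
  filter_upwards [h1, (mem_regularSubdiff_constrainedCost.1 hv).2 (ε / 2) (half_pos hε)]
    with u h1 h2 hu
  have h3 := h2 hu
  rw [inner_sub_left, inner_gradient_left]
  have h4 := (abs_le.1 h1).2
  linarith

variable [NormedAddCommGroup F] [InnerProductSpace ℝ F] [FiniteDimensional ℝ F]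

theorem zero_mem_regularSubdiff {f : E → ℝ} {g : E → F} {Θ : Set F} {x : E} {y : F}
    (hf : DifferentiableAt ℝ f x) (hg : DifferentiableAt ℝ g x)
    (hy : y ∈ convexNormalCone Θ (g x))
    (h0 : gradient f x + (fderiv ℝ g x).adjoint y = 0) :
    0 ∈ regularSubdiff (constrainedCost f g Θ) x := by
  refine mem_regularSubdiff_constrainedCost.2 ⟨hy.1, fun ε hε => ?_⟩
  have hc : 0 < ε / (2 * (‖y‖ + 1)) := by positivity
  filter_upwards [hf.hasFDerivAt.isLittleO.def (half_pos hε), hg.hasFDerivAt.isLittleO.def hc]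
    with u h1 h2 hu
  have h3 := (abs_le.1 h1).1
  have h4 := hy.2 _ hu
  have h5 : fderiv ℝ f x (u - x) = - inner ℝ y (fderiv ℝ g x (u - x)) := by
    rw [← inner_gradient_left, eq_neg_of_add_eq_zero_left h0, inner_neg_left,
      ContinuousLinearMap.adjoint_inner_left]
  have h6 : inner ℝ y (g u - g x - fderiv ℝ g x (u - x)) =
      inner ℝ y (g u - g x) - inner ℝ y (fderiv ℝ g x (u - x)) := inner_sub_right _ _ _
  have h7 := (abs_le.1 (abs_real_inner_le_norm y (g u - g x - fderiv ℝ g x (u - x)))).1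
  have h8 : ‖y‖ * ‖g u - g x - fderiv ℝ g x (u - x)‖ ≤ ε / 2 * ‖u - x‖ := by
    calc _ ≤ ‖y‖ * (ε / (2 * (‖y‖ + 1)) * ‖u - x‖) := mul_le_mul_of_nonneg_left h2 (norm_nonneg _)
      _ = (‖y‖ / (‖y‖ + 1)) * (ε / 2 * ‖u - x‖) := by field_simp
      _ ≤ 1 * (ε / 2 * ‖u - x‖) := by
        refine mul_le_mul_of_nonneg_right ?_ (by positivity)
        rw [div_le_one (by positivity)]; linarith
      _ = _ := one_mul _
  rw [inner_zero_left]
  linarith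

/-- Under MSCQ, subgradients of `f + δ_Γ` near the reference point have bounded multipliers. -/
theorem exists_bounded_multiplier {f : E → ℝ} {g : E → F} {Θ : Set F} (hΘ : Convex ℝ Θ)
    (hcl : IsClosed Θ) {x₀ : E} (hf : ContDiffAt ℝ 2 f x₀) (hg : ContDiffAt ℝ 2 g x₀)
    (hM : MSCQ g Θ x₀) :
    ∃ ρ : ℝ, 0 < ρ ∧ ∃ C : ℝ, 0 ≤ C ∧ ∀ x ∈ Metric.ball x₀ ρ, ∀ v ∈ Metric.ball (0 : E) ρ,
      v ∈ limitingSubdiff (constrainedCost f g Θ) x → g x ∈ Θ ∧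
        ∃ y ∈ convexNormalCone Θ (g x), ‖y‖ ≤ C ∧
          v = gradient f x + (fderiv ℝ g x).adjoint y := by
  obtain ⟨-, κ, hκ, hsub⟩ := hM
  have hgc := (ContDiffAt.differentiableAt_gradient hf).continuousAt
  have hbd : ∀ᶠ x in 𝓝 x₀, ‖gradient f x‖ < ‖gradient f x₀‖ + 1 :=
    hgc.norm.eventually (gt_mem_nhds (lt_add_one _))
  obtain ⟨ρ, hρ, hball⟩ := Metric.eventually_nhds_iff_ball.1
    ((hf.eventually (by simp)).and ((hg.eventually (by simp)).and
      (hbd.and (eventually_eventually_nhds.2 hsub))))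
  -- The multiplier of `v` has norm at most `κ‖v - ∇f(x)‖`; the first `1` bounds `‖v‖`, the bracket
  -- bounds `‖∇f(x)‖` near `x₀`.
  set C := κ * (1 + (‖gradient f x₀‖ + 1)) with hC
  refine ⟨min ρ 1, by positivity, C, by positivity, fun x hx v hv hmem => ?_⟩
  have hx' : x ∈ Metric.ball x₀ ρ := Metric.ball_subset_ball (min_le_left _ _) hx
  have hv' : v ∈ Metric.ball (0 : E) 1 := Metric.ball_subset_ball (min_le_right _ _) hv
  have hgx := mem_of_mem_limitingSubdiff_constrainedCost hmem
  obtain ⟨-, -, xs, vs, hxs, -, hvs, hreg⟩ := hmem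
  obtain ⟨N, hN⟩ := eventually_atTop.1
    ((hxs.eventually (Metric.isOpen_ball.mem_nhds hx')).and
      (hvs.eventually (Metric.isOpen_ball.mem_nhds hv')))
  have hex : ∀ k, ∃ y ∈ convexNormalCone Θ (g (xs (k + N))), ‖y‖ ≤ C ∧
      vs (k + N) = gradient f (xs (k + N)) + (fderiv ℝ g (xs (k + N))).adjoint y := by
    intro k
    obtain ⟨hk1, hk2⟩ := hN (k + N) (Nat.le_add_left _ _)
    obtain ⟨c1, c2, c3, c4⟩ := hball _ hk1
    obtain ⟨y, hy, hyn, hye⟩ := exists_multiplier_of_regularNormal hΘ hcl hκ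
      (c2.differentiableAt (by simp)) (mem_regularSubdiff_constrainedCost.1 (hreg _)).1 c4
      (eventually_inner_le_of_mem_regularSubdiff (c1.differentiableAt (by simp)) (hreg _))
    refine ⟨y, hy, hyn.trans (mul_le_mul_of_nonneg_left ?_ hκ.le), ?_⟩
    · refine (norm_sub_le _ _).trans (add_le_add ?_ c3.le)
      exact (mem_ball_zero_iff.1 hk2).le
    · rw [hye]; abel
  choose ys hy hyC hye using hex
  obtain ⟨y, -, φ, hφ, hylim⟩ := tendsto_subseq_of_bounded
    (Metric.isBounded_closedBall (x := (0 : F)) (r := C)) (x := ys) (fun k => by simpa using hyC k)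
  obtain ⟨c1, c2, -, -⟩ := hball _ hx'
  have hxs' : Tendsto (fun k => xs (φ k + N)) atTop (𝓝 x) :=
    hxs.comp ((tendsto_add_atTop_nat N).comp hφ.tendsto_atTop)
  have hvs' : Tendsto (fun k => vs (φ k + N)) atTop (𝓝 v) :=
    hvs.comp ((tendsto_add_atTop_nat N).comp hφ.tendsto_atTop)
  have hgxs : Tendsto (fun k => g (xs (φ k + N))) atTop (𝓝 (g x)) :=
    c2.continuousAt.tendsto.comp hxs'
  refine ⟨hgx, y, mem_convexNormalCone_of_tendsto hgxs hylim hgx fun k => hy _, ?_, ?_⟩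
  · exact le_of_tendsto hylim.norm (Eventually.of_forall fun k => hyC _)
  · have h1 : Tendsto (fun k => (fderiv ℝ g (xs (φ k + N))).adjoint) atTop
        (𝓝 (fderiv ℝ g x).adjoint) :=
      (ContinuousLinearMap.adjoint.continuous.tendsto _).comp
        ((c2.fderiv_right (m := 1) le_rfl).continuousAt.tendsto.comp hxs')
    have h2 := ((ContDiffAt.differentiableAt_gradient c1).continuousAt.tendsto.comp hxs').add
      (tendsto_continuousLinearMap_apply h1 hylim)
    exact tendsto_nhds_unique hvs' (h2.congr fun k => (hye (φ k)).symm)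

/-- Under MSCQ, `f + δ_Γ` is prox-regular at the reference point for `0`. -/
theorem exists_prox_regular {f : E → ℝ} {g : E → F} {Θ : Set F} (hΘ : Convex ℝ Θ)
    (hcl : IsClosed Θ) {x₀ : E} (hf : ContDiffAt ℝ 2 f x₀) (hg : ContDiffAt ℝ 2 g x₀)
    (hM : MSCQ g Θ x₀) :
    ∃ ρ : ℝ, 0 < ρ ∧ ∃ r : ℝ, 0 < r ∧ ∀ x ∈ Metric.ball x₀ ρ, ∀ v ∈ Metric.ball (0 : E) ρ,
      v ∈ limitingSubdiff (constrainedCost f g Θ) x → ∀ u ∈ Metric.ball x₀ ρ, g u ∈ Θ →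
        f x + inner ℝ v (u - x) - r / 2 * ‖u - x‖ ^ 2 ≤ f u := by
  obtain ⟨ρ₁, hρ₁, C, hC, hmul⟩ := exists_bounded_multiplier hΘ hcl hf hg hM
  obtain ⟨L₁, hL₁, ρ₂, hρ₂, hT₁⟩ := ContDiffAt.exists_taylor_bound hf
  obtain ⟨L₂, hL₂, ρ₃, hρ₃, hT₂⟩ := ContDiffAt.exists_taylor_bound hg
  have h12 : min ρ₁ (min ρ₂ ρ₃) ≤ ρ₂ := (min_le_right _ _).trans (min_le_left _ _)
  have h13 : min ρ₁ (min ρ₂ ρ₃) ≤ ρ₃ := (min_le_right _ _).trans (min_le_right _ _)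
  -- `L₁ + C * L₂` bounds the Taylor error of the Lagrangian; it is doubled to match `r / 2`, and
  -- the added `1` makes `r` positive.
  refine ⟨min ρ₁ (min ρ₂ ρ₃), by positivity, 2 * (L₁ + C * L₂) + 1, by positivity,
    fun x hx v hv hmem u hu hgu => ?_⟩
  obtain ⟨hgx, y, hy, hyC, rfl⟩ := hmul x (Metric.ball_subset_ball (min_le_left _ _) hx) v
    (Metric.ball_subset_ball (min_le_left _ _) hv) hmem
  have t1 := hT₁ x (Metric.ball_subset_ball h12 hx) u (Metric.ball_subset_ball h12 hu)
  have t2 := hT₂ x (Metric.ball_subset_ball h13 hx) u (Metric.ball_subset_ball h13 hu)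
  have t1' := (abs_le.1 t1).1
  have h1 := hy.2 _ hgu
  have h2 : inner ℝ y (g u - g x - fderiv ℝ g x (u - x)) =
      inner ℝ y (g u - g x) - inner ℝ y (fderiv ℝ g x (u - x)) := inner_sub_right _ _ _
  have h3 := (abs_le.1 (abs_real_inner_le_norm y (g u - g x - fderiv ℝ g x (u - x)))).1
  have h4 : ‖y‖ * ‖g u - g x - fderiv ℝ g x (u - x)‖ ≤ C * (L₂ * ‖u - x‖ ^ 2) :=
    mul_le_mul hyC t2 (norm_nonneg _) hC
  rw [inner_add_left, inner_gradient_left, ContinuousLinearMap.adjoint_inner_left]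
  nlinarith [sq_nonneg ‖u - x‖]

end LocalData

/-! ### Local proximal map, Moreau envelope and uniform quadratic growth. -/

section Prox

/-- A function on `[0, 1]` whose decrease is bounded by a quadratic in the increment of the
argument does not decrease. -/
theorem le_of_forall_sub_sq_le {G : ℝ → ℝ} {c : ℝ}
    (hG : ∀ a b, 0 ≤ a → a ≤ b → b ≤ 1 → G a - c * (b - a) ^ 2 ≤ G b) : G 0 ≤ G 1 := by
  have step : ∀ n : ℕ, G 0 - c * (1 / ((n : ℝ) + 1)) ≤ G 1 := by
    intro n
    have hn : (0 : ℝ) < (n : ℝ) + 1 := by positivity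
    -- Across `n + 1` equal steps, each loses at most `c / (n + 1) ^ 2`, so the total loss `c / (n +
    -- 1)` vanishes in the limit.
    have hi : ∀ i : ℕ, i ≤ n + 1 →
        G 0 - i * (c * (1 / ((n : ℝ) + 1)) ^ 2) ≤ G (i * (1 / ((n : ℝ) + 1))) := by
      intro i
      induction i with
      | zero => simp
      | succ i ih =>
        intro hle
        have h1 := ih (by omega)
        have hle' : ((i + 1 : ℕ) : ℝ) ≤ (n : ℝ) + 1 := by exact_mod_cast hle
        have h2 := hG (i * (1 / ((n : ℝ) + 1))) ((i + 1 : ℕ) * (1 / ((n : ℝ) + 1)))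
          (by positivity) (by push_cast; gcongr; linarith)
          (by rw [mul_one_div, div_le_one hn]; exact hle')
        have h3 : ((i + 1 : ℕ) : ℝ) * (1 / ((n : ℝ) + 1)) - i * (1 / ((n : ℝ) + 1)) =
          1 / ((n : ℝ) + 1) := by push_cast; ring
        rw [h3] at h2
        refine le_trans ?_ h2
        push_cast
        linarith
    have h4 := hi (n + 1) le_rfl
    have h5 : ((n + 1 : ℕ) : ℝ) * (1 / ((n : ℝ) + 1)) = 1 := by push_cast; field_simp
    have h6 : ((n + 1 : ℕ) : ℝ) * (c * (1 / ((n : ℝ) + 1)) ^ 2) = c * (1 / ((n : ℝ) + 1)) := by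
      push_cast; field_simp
    rwa [h5, h6] at h4
  have hlim : Tendsto (fun n : ℕ => G 0 - c * (1 / ((n : ℝ) + 1))) atTop (𝓝 (G 0 - c * 0)) :=
    tendsto_const_nhds.sub (tendsto_one_div_add_atTop_nhds_zero_nat.const_mul c)
  have := le_of_tendsto hlim (Eventually.of_forall step)
  linarith

variable {E : Type*} [NormedAddCommGroup E] [InnerProductSpace ℝ E]

/-- The function `f + δ_Γ` with subgradient mapping `S` is prox-regular at `x₀` for `0`, with
constant `r` on balls of radius `ρ`, and the graphical derivative of `S` is there bounded below
by `σ`. -/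
structure HasPositiveGraphicalDerivative (f : E → ℝ) (Γ : Set E) (S : E → Set E) (x₀ : E)
    (ρ r σ : ℝ) : Prop where
  radius_pos : 0 < ρ
  prox_pos : 0 < r
  modulus_nonneg : 0 ≤ σ
  continuousOn : ContinuousOn f (Metric.ball x₀ ρ)
  isCompact : IsCompact (Γ ∩ Metric.closedBall x₀ (ρ / 2))
  base_mem : x₀ ∈ Γ
  zero_mem : 0 ∈ S x₀
  mem_of_mem : ∀ x, ∀ v ∈ S x, x ∈ Γ
  of_isLocalMinOn : ∀ x ∈ Γ, ∀ z, ∀ s : ℝ, 0 < s →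
    IsLocalMinOn (fun u => f u + s / 2 * ‖u - z‖ ^ 2) Γ x → s • (z - x) ∈ S x
  prox_regular : ∀ x ∈ Metric.ball x₀ ρ, ∀ v ∈ Metric.ball (0 : E) ρ, v ∈ S x →
    ∀ u ∈ Metric.ball x₀ ρ, u ∈ Γ → f x + inner ℝ v (u - x) - r / 2 * ‖u - x‖ ^ 2 ≤ f u
  le_inner : ∀ x ∈ Metric.ball x₀ ρ, ∀ v ∈ Metric.ball (0 : E) ρ, v ∈ S x →
    ∀ (t : ℕ → ℝ) (ws qs : ℕ → E) (w q : E), (∀ k, 0 < t k) → Tendsto t atTop (𝓝 0) →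
      Tendsto ws atTop (𝓝 w) → Tendsto qs atTop (𝓝 q) →
      (∀ k, x + t k • ws k ∈ Metric.ball x₀ ρ ∧ v + t k • qs k ∈ Metric.ball (0 : E) ρ ∧
        v + t k • qs k ∈ S (x + t k • ws k)) → σ * ‖w‖ ^ 2 ≤ inner ℝ q w

/-- `P` is a proximal mapping of `f + δ_Γ` with parameter `s⁻¹`, localized around `x₀`. -/
structure IsLocalProxMap (f : E → ℝ) (Γ : Set E) (S : E → Set E) (x₀ : E) (ρ s δ : ℝ)
    (P : E → E) : Prop where
  norm_sub_le : ∀ z ∈ Metric.ball x₀ δ, ‖P z - x₀‖ ≤ 3 * ‖z - x₀‖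
  mem_ball : ∀ z ∈ Metric.ball x₀ δ, P z ∈ Metric.ball x₀ (ρ / 2)
  smul_mem_ball : ∀ z ∈ Metric.ball x₀ δ, s • (z - P z) ∈ Metric.ball (0 : E) ρ
  smul_mem : ∀ z ∈ Metric.ball x₀ δ, s • (z - P z) ∈ S (P z)
  le : ∀ z ∈ Metric.ball x₀ δ, ∀ u ∈ Γ, u ∈ Metric.closedBall x₀ (ρ / 2) →
    f (P z) + s / 2 * ‖P z - z‖ ^ 2 ≤ f u + s / 2 * ‖u - z‖ ^ 2

namespace HasPositiveGraphicalDerivative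

variable {f : E → ℝ} {Γ : Set E} {S : E → Set E} {x₀ : E} {ρ r σ δ : ℝ} {P : E → E}

/-- Minimize over the compact piece of `Γ` in the ball of radius `ρ / 2`. Prox-regularity at `(x₀,
0)` keeps the minimizer `p` within `3‖z - x₀‖` of `x₀`, hence inside the open ball, where the
optimality condition gives a subgradient. -/
theorem exists_isLocalProxMap (H : HasPositiveGraphicalDerivative f Γ S x₀ ρ r σ) :
    ∃ δ : ℝ, 0 < δ ∧ ∃ P : E → E, IsLocalProxMap f Γ S x₀ ρ (4 * r) δ P := by
  have hρ := H.radius_pos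
  have hr := H.prox_pos
  -- The two bounds give `3δ ≤ ρ / 2`, which localizes `P z`, and `4r · 4δ ≤ ρ`, which localizes `4r
  -- (z - P z)`.
  set δ := min (ρ / 6) (ρ / (16 * r)) with hδ
  have hδpos : 0 < δ := by positivity
  have hsub : Metric.closedBall x₀ (ρ / 2) ⊆ Metric.ball x₀ ρ :=
    Metric.closedBall_subset_ball (by linarith)
  have key : ∀ z ∈ Metric.ball x₀ δ, ∃ p, ‖p - x₀‖ ≤ 3 * ‖z - x₀‖ ∧
      p ∈ Metric.ball x₀ (ρ / 2) ∧ (4 * r) • (z - p) ∈ Metric.ball (0 : E) ρ ∧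
      (4 * r) • (z - p) ∈ S p ∧ ∀ u ∈ Γ, u ∈ Metric.closedBall x₀ (ρ / 2) →
        f p + (4 * r) / 2 * ‖p - z‖ ^ 2 ≤ f u + (4 * r) / 2 * ‖u - z‖ ^ 2 := by
    intro z hz
    rw [mem_ball_iff_norm] at hz
    have hcont : ContinuousOn (fun u => f u + (4 * r) / 2 * ‖u - z‖ ^ 2)
        (Γ ∩ Metric.closedBall x₀ (ρ / 2)) := by
      refine (H.continuousOn.mono (Set.inter_subset_right.trans hsub)).add ?_
      exact Continuous.continuousOn (by fun_prop)
    obtain ⟨p, ⟨hpΓ, hpB⟩, hmin⟩ := H.isCompact.exists_isMinOn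
      ⟨x₀, H.base_mem, Metric.mem_closedBall_self (by positivity)⟩ hcont
    have hle : ∀ u ∈ Γ, u ∈ Metric.closedBall x₀ (ρ / 2) →
        f p + (4 * r) / 2 * ‖p - z‖ ^ 2 ≤ f u + (4 * r) / 2 * ‖u - z‖ ^ 2 :=
      fun u hu hu' => hmin ⟨hu, hu'⟩
    have h0 := hle x₀ H.base_mem (Metric.mem_closedBall_self (by positivity))
    have h1 := H.prox_regular x₀ (Metric.mem_ball_self hρ) 0 (Metric.mem_ball_self hρ) H.zero_mem
      p (hsub hpB) hpΓ
    rw [inner_zero_left] at h1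
    have h2 : ‖p - x₀‖ ≤ ‖p - z‖ + ‖z - x₀‖ := norm_sub_le_norm_sub_add_norm_sub p z x₀
    have h3 : ‖x₀ - z‖ = ‖z - x₀‖ := norm_sub_rev _ _
    rw [h3] at h0
    have hn1 := norm_nonneg (p - x₀)
    have hn2 := norm_nonneg (z - x₀)
    have hn3 := norm_nonneg (p - z)
    have hquad : 4 * ‖p - z‖ ^ 2 ≤ 4 * ‖z - x₀‖ ^ 2 + ‖p - x₀‖ ^ 2 := by
      refine le_of_mul_le_mul_left ?_ (half_pos hr)
      linarith
    have hp3 : ‖p - x₀‖ ≤ 3 * ‖z - x₀‖ := by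
      by_contra hcon
      push Not at hcon
      nlinarith
    have hδ1 : ‖z - x₀‖ < ρ / 6 := hz.trans_le (min_le_left _ _)
    have hδ2 : ‖z - x₀‖ < ρ / (16 * r) := hz.trans_le (min_le_right _ _)
    have hpin : p ∈ Metric.ball x₀ (ρ / 2) := by rw [mem_ball_iff_norm]; linarith
    refine ⟨p, hp3, hpin, ?_, ?_, hle⟩
    · rw [mem_ball_zero_iff, norm_smul, Real.norm_eq_abs, abs_of_pos (by positivity)]
      have h4 : ‖z - p‖ ≤ 4 * ‖z - x₀‖ := by
        have := norm_sub_le_norm_sub_add_norm_sub z x₀ p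
        rw [norm_sub_rev x₀ p] at this
        linarith
      rw [lt_div_iff₀ (by positivity)] at hδ2
      nlinarith
    · refine H.of_isLocalMinOn p hpΓ z _ (by positivity) ?_
      filter_upwards [self_mem_nhdsWithin,
        mem_nhdsWithin_of_mem_nhds (Metric.isOpen_ball.mem_nhds hpin)] with u hu hu'
      exact hle u hu (Metric.ball_subset_closedBall hu')
  choose! P hP using key
  exact ⟨δ, hδpos, P, fun z hz => (hP z hz).1, fun z hz => (hP z hz).2.1,
    fun z hz => (hP z hz).2.2.1, fun z hz => (hP z hz).2.2.2.1, fun z hz => (hP z hz).2.2.2.2⟩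

/-- Adding the prox-regular inequalities at the two points gives `(4r - r)‖x₁ - x₂‖² ≤ 4r ⟨z₁ - z₂,
x₁ - x₂⟩`. It serves both as Lipschitz continuity of `P` and, for `z₁ = z₂`, as uniqueness of the
proximal point. -/
theorem norm_sub_le (H : HasPositiveGraphicalDerivative f Γ S x₀ ρ r σ) {x₁ x₂ z₁ z₂ : E}
    (hx₁ : x₁ ∈ Metric.ball x₀ ρ) (hx₂ : x₂ ∈ Metric.ball x₀ ρ)
    (hv₁ : (4 * r) • (z₁ - x₁) ∈ Metric.ball (0 : E) ρ)
    (hv₂ : (4 * r) • (z₂ - x₂) ∈ Metric.ball (0 : E) ρ)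
    (hS₁ : (4 * r) • (z₁ - x₁) ∈ S x₁) (hS₂ : (4 * r) • (z₂ - x₂) ∈ S x₂) :
    ‖x₁ - x₂‖ ≤ 2 * ‖z₁ - z₂‖ := by
  have hr := H.prox_pos
  have h1 := H.prox_regular x₁ hx₁ _ hv₁ hS₁ x₂ hx₂ (H.mem_of_mem _ _ hS₂)
  have h2 := H.prox_regular x₂ hx₂ _ hv₂ hS₂ x₁ hx₁ (H.mem_of_mem _ _ hS₁)
  rw [real_inner_smul_left] at h1 h2
  rw [norm_sub_rev x₂ x₁] at h1
  have h3 : inner ℝ (z₁ - x₁) (x₂ - x₁) + inner ℝ (z₂ - x₂) (x₁ - x₂) =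
      ‖x₁ - x₂‖ ^ 2 - inner ℝ (z₁ - z₂) (x₁ - x₂) := by
    rw [← real_inner_self_eq_norm_sq, ← inner_sub_left, ← neg_sub x₁ x₂, inner_neg_right,
      ← inner_neg_left, ← inner_add_left]
    congr 1; abel
  have h4 := real_inner_le_norm (z₁ - z₂) (x₁ - x₂)
  have h5 : 3 * ‖x₁ - x₂‖ ^ 2 ≤ 4 * (‖z₁ - z₂‖ * ‖x₁ - x₂‖) := by
    refine le_of_mul_le_mul_left ?_ hr
    nlinarith
  by_contra hcon
  push Not at hcon
  nlinarith [norm_nonneg (x₁ - x₂), norm_nonneg (z₁ - z₂)]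

variable [FiniteDimensional ℝ E]

/-- The gradient `z ↦ s (z - P z)` of the Moreau envelope is strongly monotone on segments. -/
theorem inner_add_le_inner (H : HasPositiveGraphicalDerivative f Γ S x₀ ρ r σ)
    (hP : IsLocalProxMap f Γ S x₀ ρ (4 * r) δ P) {z h : E} (hz : z ∈ Metric.ball x₀ δ)
    (hzh : z + h ∈ Metric.ball x₀ δ) {t : ℝ} (ht : t ∈ Set.Icc (0 : ℝ) 1) :
    inner ℝ ((4 * r) • (z - P z)) h + σ * (4 * r) / (σ + 4 * r) * ‖h‖ ^ 2 * t ≤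
      inner ℝ ((4 * r) • (z + t • h - P (z + t • h))) h := by
  have hr := H.prox_pos
  have hσ := H.modulus_nonneg
  have hρ := H.radius_pos
  have hhalf : Metric.ball x₀ (ρ / 2) ⊆ Metric.ball x₀ ρ := Metric.ball_subset_ball (by linarith)
  set s := 4 * r with hs
  have hspos : 0 < s := by positivity
  set μ := σ * s / (σ + s) with hμ
  have hseg : ∀ τ ∈ Set.Icc (0 : ℝ) 1, z + τ • h ∈ Metric.ball x₀ δ := by
    intro τ hτ
    have := (convex_ball x₀ δ).add_smul_sub_mem hz hzh hτ
    rwa [add_sub_cancel_left] at this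
  have hlip : ∀ a ∈ Set.Icc (0 : ℝ) 1, ∀ b ∈ Set.Icc (0 : ℝ) 1,
      ‖P (z + a • h) - P (z + b • h)‖ ≤ 2 * ‖h‖ * |a - b| := by
    intro a ha b hb
    have ha' := hseg a ha
    have hb' := hseg b hb
    have := H.norm_sub_le (hhalf (hP.mem_ball _ ha')) (hhalf (hP.mem_ball _ hb'))
      (hP.smul_mem_ball _ ha') (hP.smul_mem_ball _ hb') (hP.smul_mem _ ha') (hP.smul_mem _ hb')
    rw [add_sub_add_left_eq_sub, ← sub_smul, norm_smul, Real.norm_eq_abs] at this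
    linarith
  set k : ℝ → ℝ := fun τ => inner ℝ (s • (z + τ • h - P (z + τ • h))) h with hk
  have hPcont : ContinuousOn (fun τ => P (z + τ • h)) (Set.Icc (0 : ℝ) 1) := by
    refine (LipschitzOnWith.of_dist_le_mul (K := (2 * ‖h‖).toNNReal) fun a ha b hb => ?_).continuousOn
    rw [dist_eq_norm, Real.dist_eq, Real.coe_toNNReal _ (by positivity)]
    exact hlip a ha b hb
  have hkcont : ContinuousOn (fun τ => -k τ) (Set.Icc (0 : ℝ) 1) := by
    refine ContinuousOn.neg (ContinuousOn.inner (𝕜 := ℝ) (ContinuousOn.const_smul ?_ s)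
      continuousOn_const)
    exact (Continuous.continuousOn (by fun_prop)).sub hPcont
  have hk0 : k 0 = inner ℝ (s • (z - P z)) h := by simp [hk]
  -- `P` need not be differentiable, so the linear bound is integrated by a Dini-derivative
  -- comparison, which asks only for suitable right slopes at arbitrarily small steps.
  have main := image_le_of_liminf_slope_right_le_deriv_boundary (f := fun τ => -k τ) (a := 0)
    (b := 1) hkcont (B := fun τ => -k 0 - μ * ‖h‖ ^ 2 * τ) (B' := fun _ => -(μ * ‖h‖ ^ 2))
    (by simp) (by fun_prop) (fun τ _ => ?_) (fun τ hτ R hR => ?_) ht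
  · rw [← hk0]
    have : -k t ≤ -k 0 - μ * ‖h‖ ^ 2 * t := main
    change _ ≤ k t
    linarith
  · have h1 := ((hasDerivAt_id τ).const_mul (μ * ‖h‖ ^ 2)).const_sub (-k 0)
    simpa using h1.hasDerivWithinAt
  · have hτ' : τ ∈ Set.Icc (0 : ℝ) 1 := ⟨hτ.1, hτ.2.le⟩
    have h1τ : 0 < 1 - τ := by linarith [hτ.2]
    set ε : ℕ → ℝ := fun j => (1 - τ) * (1 / ((j : ℝ) + 1)) with hε
    have hεpos : ∀ j, 0 < ε j := fun j => by positivity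
    have hεlim : Tendsto ε atTop (𝓝 0) := by
      simpa [hε] using tendsto_one_div_add_atTop_nhds_zero_nat.const_mul (1 - τ)
    have hεmem : ∀ j, τ + ε j ∈ Set.Icc (0 : ℝ) 1 := fun j => by
      have h1 : (1 : ℝ) / ((j : ℝ) + 1) ≤ 1 := by
        rw [div_le_one (by positivity)]; linarith [(Nat.cast_nonneg j : (0:ℝ) ≤ j)]
      have h2 : ε j ≤ (1 - τ) * 1 := mul_le_mul_of_nonneg_left h1 h1τ.le
      exact ⟨by linarith [hτ.1, hεpos j], by linarith⟩
    set p : ℝ → E := fun a => P (z + a • h) with hp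
    set w : ℕ → E := fun j => (ε j)⁻¹ • (p (τ + ε j) - p τ) with hw
    have hwb : ∀ j, w j ∈ Metric.closedBall (0 : E) (2 * ‖h‖) := fun j => by
      have := hlip _ (hεmem j) τ hτ'
      rw [add_sub_cancel_left, abs_of_pos (hεpos j)] at this
      rw [mem_closedBall_zero_iff, norm_smul, norm_inv, Real.norm_eq_abs, abs_of_pos (hεpos j),
        inv_mul_le_iff₀ (hεpos j)]
      linarith
    obtain ⟨w₀, -, φ, hφ, hwlim⟩ := tendsto_subseq_of_bounded Metric.isBounded_closedBall hwb
    have hεw : ∀ j, ε j • w j = p (τ + ε j) - p τ := fun j => by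
      rw [hw]; simp only; rw [smul_smul, mul_inv_cancel₀ (hεpos j).ne', one_smul]
    have hxeq : ∀ j, p τ + ε j • w j = P (z + (τ + ε j) • h) := fun j => by
      rw [hεw]; simp [hp]
    have hveq : ∀ j, s • (z + τ • h - p τ) + ε j • (s • (h - w j)) =
        s • (z + (τ + ε j) • h - P (z + (τ + ε j) • h)) := fun j => by
      rw [smul_comm (ε j) s, smul_sub (ε j), hεw, ← smul_add, add_smul]
      congr 1
      simp only [hp]
      rw [add_smul]
      abel
    have hqlim : Tendsto (fun j => s • (h - w (φ j))) atTop (𝓝 (s • (h - w₀))) :=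
      (tendsto_const_nhds.sub hwlim).const_smul s
    have hzτ := hseg τ hτ'
    -- A limit `w₀` of difference quotients of `P` in direction `h` makes `(w₀, s(h - w₀))` a
    -- tangent direction to the graph of `S`.
    have hD := H.le_inner (p τ) (hhalf (hP.mem_ball _ hzτ)) (s • (z + τ • h - p τ))
      (hP.smul_mem_ball _ hzτ) (hP.smul_mem _ hzτ) (fun j => ε (φ j)) (fun j => w (φ j))
      (fun j => s • (h - w (φ j))) w₀ (s • (h - w₀)) (fun j => hεpos _)
      (hεlim.comp hφ.tendsto_atTop) hwlim hqlim (fun j => by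
        have hz' := hseg _ (hεmem (φ j))
        simp only [hxeq, hveq]
        exact ⟨hhalf (hP.mem_ball _ hz'), hP.smul_mem_ball _ hz', hP.smul_mem _ hz'⟩)
    -- Splitting `h = w₀ + (h - w₀)` bounds the pairing below by `σ‖w₀‖² + s‖h - w₀‖²`. The minimum
    -- of this over `w₀` is `σs/(σ + s) ‖h‖²`, attained where the square in `e3` vanishes.
    have hbound : μ * ‖h‖ ^ 2 ≤ inner ℝ (s • (h - w₀)) h := by
      have e1 : inner ℝ (s • (h - w₀)) h = inner ℝ (s • (h - w₀)) w₀ + s * ‖h - w₀‖ ^ 2 := by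
        rw [← real_inner_self_eq_norm_sq, ← real_inner_smul_left, ← inner_add_right]
        congr 1; abel
      have e2 : ‖h‖ ^ 2 = ‖w₀‖ ^ 2 + 2 * inner ℝ w₀ (h - w₀) + ‖h - w₀‖ ^ 2 := by
        rw [← norm_add_sq_real]; congr 2; abel
      have e3 : 0 ≤ ‖σ • w₀ - s • (h - w₀)‖ ^ 2 := by positivity
      rw [norm_sub_sq_real, norm_smul, norm_smul, mul_pow, mul_pow, Real.norm_eq_abs,
        Real.norm_eq_abs, sq_abs, sq_abs, real_inner_smul_left, real_inner_smul_right] at e3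
      have e4 : μ * ‖h‖ ^ 2 ≤ σ * ‖w₀‖ ^ 2 + s * ‖h - w₀‖ ^ 2 := by
        rw [hμ, div_mul_eq_mul_div, div_le_iff₀ (by positivity), e2]
        nlinarith
      linarith
    have hslope : Tendsto (fun j => slope (fun τ => -k τ) τ (τ + ε (φ j))) atTop
        (𝓝 (-inner ℝ (s • (h - w₀)) h)) := by
      have : ∀ j, slope (fun τ => -k τ) τ (τ + ε (φ j)) = -inner ℝ (s • (h - w (φ j))) h := by
        intro j
        have h1 : k (τ + ε (φ j)) = k τ + ε (φ j) * inner ℝ (s • (h - w (φ j))) h := by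
          simp only [hk]
          rw [← hveq, inner_add_left, real_inner_smul_left _ _ (ε (φ j))]
        rw [slope_def_field, h1, add_sub_cancel_left, div_eq_iff (hεpos (φ j)).ne']
        ring
      simp only [this]
      exact (hqlim.inner tendsto_const_nhds).neg
    have hev : ∀ᶠ j in atTop, slope (fun τ => -k τ) τ (τ + ε (φ j)) < R :=
      hslope.eventually (gt_mem_nhds (by linarith))
    have hto : Tendsto (fun j => τ + ε (φ j)) atTop (𝓝[>] τ) := by
      refine tendsto_nhdsWithin_iff.2 ⟨?_, Eventually.of_forall fun j => ?_⟩
      · simpa using tendsto_const_nhds.add (hεlim.comp hφ.tendsto_atTop)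
      · exact lt_add_of_pos_right _ (hεpos _)
    exact hto.frequently hev.frequently

/-- Strong convexity inequality for the Moreau envelope. -/
theorem envelope_add_le (H : HasPositiveGraphicalDerivative f Γ S x₀ ρ r σ)
    (hP : IsLocalProxMap f Γ S x₀ ρ (4 * r) δ P) {z h : E} (hz : z ∈ Metric.ball x₀ δ)
    (hzh : z + h ∈ Metric.ball x₀ δ) :
    f (P z) + (4 * r) / 2 * ‖P z - z‖ ^ 2 + inner ℝ ((4 * r) • (z - P z)) h +
      σ * (4 * r) / (σ + 4 * r) / 2 * ‖h‖ ^ 2 ≤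
      f (P (z + h)) + (4 * r) / 2 * ‖P (z + h) - (z + h)‖ ^ 2 := by
  have hr := H.prox_pos
  set s := 4 * r with hs
  set μ := σ * s / (σ + s) with hμ
  set e : ℝ → ℝ := fun t => f (P (z + t • h)) + s / 2 * ‖P (z + t • h) - (z + t • h)‖ ^ 2 with he
  set K := inner ℝ (s • (z - P z)) h with hK
  have hseg : ∀ τ ∈ Set.Icc (0 : ℝ) 1, z + τ • h ∈ Metric.ball x₀ δ := by
    intro τ hτ
    have := (convex_ball x₀ δ).add_smul_sub_mem hz hzh hτ
    rwa [add_sub_cancel_left] at this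
  -- Differentiability of the envelope is avoided: the minimality of `P (z + a • h)`, tested at `P
  -- (z + b • h)`, bounds the increment from `a` to `b` up to a multiple of `(b - a) ^ 2`.
  have main := le_of_forall_sub_sq_le (G := fun t => e t - K * t - μ * ‖h‖ ^ 2 / 2 * t ^ 2)
    (c := s / 2 * ‖h‖ ^ 2 - μ * ‖h‖ ^ 2 / 2) (fun a b ha hab hb => ?_)
  · simp only [he] at main
    norm_num at main
    linarith
  · have hb' := hseg b ⟨ha.trans hab, hb⟩
    have ha' := hseg a ⟨ha, hab.trans hb⟩
    have h1 := hP.le _ ha' _ (H.mem_of_mem _ _ (hP.smul_mem _ hb'))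
      (Metric.ball_subset_closedBall (hP.mem_ball _ hb'))
    have h2 : K + μ * ‖h‖ ^ 2 * b ≤ s * inner ℝ (z + b • h - P (z + b • h)) h := by
      rw [← real_inner_smul_left]
      exact H.inner_add_le_inner hP hz hzh ⟨ha.trans hab, hb⟩
    have h3 : ‖P (z + b • h) - (z + a • h)‖ ^ 2 = ‖P (z + b • h) - (z + b • h)‖ ^ 2 -
        2 * ((b - a) * inner ℝ (z + b • h - P (z + b • h)) h) + (b - a) ^ 2 * ‖h‖ ^ 2 := by
      have : P (z + b • h) - (z + a • h) = (P (z + b • h) - (z + b • h)) + (b - a) • h := by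
        rw [sub_smul]; abel
      rw [this, norm_add_sq_real, norm_smul, mul_pow, Real.norm_eq_abs, sq_abs,
        real_inner_smul_right, ← neg_sub (z + b • h), inner_neg_left, norm_neg]
      ring
    rw [h3] at h1
    have h4 := mul_le_mul_of_nonneg_left h2 (sub_nonneg.2 hab)
    simp only [he]
    have h5 : f (P (z + a • h)) + s / 2 * ‖P (z + a • h) - (z + a • h)‖ ^ 2 +
        (b - a) * (K + μ * ‖h‖ ^ 2 * b) - s / 2 * ((b - a) ^ 2 * ‖h‖ ^ 2) ≤
        f (P (z + b • h)) + s / 2 * ‖P (z + b • h) - (z + b • h)‖ ^ 2 := by linarith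
    linarith

/-- Uniform quadratic growth of subgradient inequalities near the reference point. -/
theorem exists_uniform_growth (H : HasPositiveGraphicalDerivative f Γ S x₀ ρ r σ) :
    ∃ η : ℝ, 0 < η ∧ ∀ x ∈ Metric.ball x₀ η, ∀ v ∈ Metric.ball (0 : E) η, v ∈ S x →
      ∀ u ∈ Metric.ball x₀ η, u ∈ Γ →
        f x + inner ℝ v (u - x) + σ / 2 * ‖u - x‖ ^ 2 ≤ f u := by
  have hr := H.prox_pos
  have hσ := H.modulus_nonneg
  have hρ := H.radius_pos
  obtain ⟨δ, hδ, P, hP⟩ := H.exists_isLocalProxMap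
  have hhalf : Metric.ball x₀ (ρ / 2) ⊆ Metric.ball x₀ ρ := Metric.ball_subset_ball (by linarith)
  set s := 4 * r with hs
  have hspos : 0 < s := by positivity
  set c := 1 + 1 / s + 2 * (σ + s) / s with hc
  have hc1 : 1 ≤ c := by
    have h1 : 0 ≤ 1 / s := by positivity
    have h2 : 0 ≤ 2 * (σ + s) / s := by positivity
    linarith
  set η := min (δ / c) (ρ / 2) with hη
  have hηpos : 0 < η := by positivity
  have hηδ : c * η ≤ δ := by
    have : η ≤ δ / c := min_le_left _ _
    rw [le_div_iff₀ (by positivity)] at this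
    linarith
  have hηρ : η ≤ ρ / 2 := min_le_right _ _
  refine ⟨η, hηpos, fun x hx v hv hvS u hu huΓ => ?_⟩
  have hxρ : x ∈ Metric.ball x₀ ρ := Metric.ball_subset_ball (by linarith) hx
  have hvρ : v ∈ Metric.ball (0 : E) ρ := Metric.ball_subset_ball (by linarith) hv
  have huρ : u ∈ Metric.closedBall x₀ (ρ / 2) :=
    Metric.ball_subset_closedBall (Metric.ball_subset_ball hηρ hu)
  rw [mem_ball_iff_norm] at hx hu
  rw [mem_ball_zero_iff] at hv
  -- This is the point whose proximal point is `x`, with envelope gradient `v`.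
  set z := x + s⁻¹ • v with hz
  set D := u - x with hD
  -- The envelope at `z + h` is at most `f u + s / 2 * ‖u - (z + h)‖ ^ 2`. Among multiples of `D`,
  -- this `h` gives the best resulting bound on `f u`, and exactly the coefficient `σ / 2`.
  set h := ((σ + s) / s) • D with hh
  have hveq : s • (z - x) = v := by
    rw [hz, add_sub_cancel_left, smul_smul, mul_inv_cancel₀ hspos.ne', one_smul]
  have hDn : ‖D‖ ≤ 2 * η := by
    have : D = (u - x₀) - (x - x₀) := by rw [hD]; abel
    rw [this]
    exact (_root_.norm_sub_le _ _).trans (by linarith)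
  have hzn : ‖z - x₀‖ < (1 + 1 / s) * η := by
    have : z - x₀ = (x - x₀) + s⁻¹ • v := by rw [hz]; abel
    rw [this]
    refine (norm_add_le _ _).trans_lt ?_
    rw [norm_smul, norm_inv, Real.norm_eq_abs, abs_of_pos hspos, add_mul, one_mul, one_div]
    exact add_lt_add hx (mul_lt_mul_of_pos_left hv (by positivity))
  have hhn : ‖h‖ ≤ 2 * (σ + s) / s * η := by
    rw [hh, norm_smul, Real.norm_eq_abs, abs_of_nonneg (by positivity)]
    calc _ ≤ (σ + s) / s * (2 * η) := mul_le_mul_of_nonneg_left hDn (by positivity)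
      _ = _ := by ring
  have hcη : c * η = (1 + 1 / s) * η + 2 * (σ + s) / s * η := by rw [hc]; ring
  have hzδ : z ∈ Metric.ball x₀ δ := by
    rw [mem_ball_iff_norm]
    have : 0 ≤ ‖h‖ := norm_nonneg _
    linarith
  have hzhδ : z + h ∈ Metric.ball x₀ δ := by
    rw [mem_ball_iff_norm]
    have h1 : z + h - x₀ = (z - x₀) + h := by abel
    rw [h1]
    refine (norm_add_le _ _).trans_lt ?_
    linarith
  have hPz : P z = x := by
    have := H.norm_sub_le (z₁ := z) (z₂ := z) (hhalf (hP.mem_ball _ hzδ)) hxρ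
      (hP.smul_mem_ball _ hzδ) (by rw [← hs, hveq]; exact hvρ) (hP.smul_mem _ hzδ)
      (by rw [← hs, hveq]; exact hvS)
    rw [sub_self, norm_zero, mul_zero] at this
    exact sub_eq_zero.1 (norm_le_zero_iff.1 this)
  have h1 := H.envelope_add_le hP hzδ hzhδ
  have h2 := hP.le _ hzhδ u huΓ huρ
  rw [← hs] at h1
  rw [hPz, hveq] at h1
  have h3 : x - z = -(s⁻¹ • v) := by rw [hz]; abel
  have h4 : u - (z + h) = -(s⁻¹ • v) - (σ / s) • D := by
    have e1 : h = D + (σ / s) • D := by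
      rw [hh, add_div, div_self hspos.ne', add_smul, one_smul, add_comm]
    rw [e1, hz, hD]; abel
  have h5 : ‖u - (z + h)‖ ^ 2 = ‖x - z‖ ^ 2 + 2 * (s⁻¹ * (σ / s * inner ℝ v D)) +
      (σ / s) ^ 2 * ‖D‖ ^ 2 := by
    rw [h4, h3, norm_sub_sq_real, inner_neg_left, real_inner_smul_left, real_inner_smul_right,
      norm_smul (σ / s), mul_pow, Real.norm_eq_abs, sq_abs]
    ring
  have h6 : inner ℝ v h = (σ + s) / s * inner ℝ v D := by rw [hh, real_inner_smul_right]
  have h7 : ‖h‖ ^ 2 = ((σ + s) / s) ^ 2 * ‖D‖ ^ 2 := by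
    rw [hh, norm_smul, mul_pow, Real.norm_eq_abs, sq_abs]
  rw [h5] at h2
  rw [h6, h7] at h1
  have h8 : s / 2 * (2 * (s⁻¹ * (σ / s * inner ℝ v D))) = σ / s * inner ℝ v D := by field_simp
  have h9 : (σ + s) / s * inner ℝ v D = inner ℝ v D + σ / s * inner ℝ v D := by field_simp; ring
  have h10 : σ * s / (σ + s) / 2 * (((σ + s) / s) ^ 2 * ‖D‖ ^ 2) -
      s / 2 * ((σ / s) ^ 2 * ‖D‖ ^ 2) = σ / 2 * ‖D‖ ^ 2 := by
    have : σ + s ≠ 0 := by positivity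
    field_simp
    ring
  linarith

end HasPositiveGraphicalDerivative

end Prox

/-! ### Variational convexity, growth and tilt stability from the uniform inequality. -/

section Consequences

theorem lowerSemicontinuousOn_constrainedCost {E F : Type*} [TopologicalSpace E]
    [TopologicalSpace F] {f : E → ℝ} {g : E → F} {Θ : Set F}
    (hcl : IsClosed Θ) {U : Set E} (hf : ∀ x ∈ U, ContinuousAt f x)
    (hg : ∀ x ∈ U, ContinuousAt g x) : LowerSemicontinuousOn (constrainedCost f g Θ) U := by
  intro x hx y hy
  refine mem_nhdsWithin_of_mem_nhds ?_
  by_cases hxΘ : g x ∈ Θ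
  · rw [constrainedCost_of_mem hxΘ] at hy
    have h1 : ContinuousAt (fun u => (f u : EReal)) x :=
      continuous_coe_real_ereal.continuousAt.comp (hf x hx)
    filter_upwards [h1.eventually (lt_mem_nhds hy)] with u hu
    exact hu.trans_le (le_constrainedCost_iff.2 fun _ => le_rfl)
  · filter_upwards [(hg x hx).eventually (hcl.isOpen_compl.mem_nhds hxΘ)] with u hu
    rw [constrainedCost_of_notMem hu]
    exact hy.trans_le le_top

variable {E F : Type*} [NormedAddCommGroup E] [InnerProductSpace ℝ E]

theorem mem_regularSubdiff_of_eventually_le {f : E → ℝ} {g : E → F} {Θ : Set F} {x v : E}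
    (hx : g x ∈ Θ) {c : ℝ} (hc : 0 ≤ c)
    (h : ∀ᶠ u in 𝓝 x, g u ∈ Θ → f x + inner ℝ v (u - x) - c * ‖u - x‖ ^ 2 ≤ f u) :
    v ∈ regularSubdiff (constrainedCost f g Θ) x := by
  refine mem_regularSubdiff_constrainedCost.2 ⟨hx, fun ε hε => ?_⟩
  filter_upwards [h, Metric.ball_mem_nhds x (show 0 < ε / (c + 1) by positivity)] with u h1 h2 hu
  rw [mem_ball_iff_norm, lt_div_iff₀ (by positivity)] at h2
  nlinarith [h1 hu, norm_nonneg (u - x)]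

theorem norm_smul_add_smul_sub_sq {x y c : E} {a b : ℝ} (hab : a + b = 1) :
    ‖a • x + b • y - c‖ ^ 2 + a * b * ‖x - y‖ ^ 2 = a * ‖x - c‖ ^ 2 + b * ‖y - c‖ ^ 2 := by
  have h1 : a • x + b • y - c = a • (x - c) + b • (y - c) := by
    obtain rfl : b = 1 - a := by linarith
    module
  have h2 : x - y = (x - c) - (y - c) := by abel
  rw [h1, h2, norm_add_sq_real, norm_sub_sq_real, norm_smul, norm_smul, mul_pow, mul_pow,
    Real.norm_eq_abs, Real.norm_eq_abs, sq_abs, sq_abs, real_inner_smul_left,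
    real_inner_smul_right]
  obtain rfl : b = 1 - a := by linarith
  ring

/-- The supremum of the quadratic functions `f p + ⟪v, · - p⟫ + σ / 2 ‖· - p‖²` over the pairs
`(p, v)` in `T`. -/
noncomputable def supQuadratic (f : E → ℝ) (σ : ℝ) (T : Set (E × E)) (u : E) : EReal :=
  ⨆ p : T, ((f p.1.1 + inner ℝ p.1.2 (u - p.1.1) + σ / 2 * ‖u - p.1.1‖ ^ 2 : ℝ) : EReal)

theorem le_supQuadratic {f : E → ℝ} {σ : ℝ} {T : Set (E × E)} {x v : E} (h : (x, v) ∈ T) (u : E) :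
    ((f x + inner ℝ v (u - x) + σ / 2 * ‖u - x‖ ^ 2 : ℝ) : EReal) ≤ supQuadratic f σ T u :=
  le_iSup (fun p : T =>
    ((f p.1.1 + inner ℝ p.1.2 (u - p.1.1) + σ / 2 * ‖u - p.1.1‖ ^ 2 : ℝ) : EReal)) ⟨(x, v), h⟩

theorem lowerSemicontinuous_supQuadratic (f : E → ℝ) (σ : ℝ) (T : Set (E × E)) :
    LowerSemicontinuous (supQuadratic f σ T) := by
  refine lowerSemicontinuous_iSup fun p => Continuous.lowerSemicontinuous ?_
  exact continuous_coe_real_ereal.comp (by fun_prop)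

theorem supQuadratic_ne_bot {f : E → ℝ} {σ : ℝ} {T : Set (E × E)} (hT : T.Nonempty) (u : E) :
    supQuadratic f σ T u ≠ ⊥ := by
  obtain ⟨⟨x, v⟩, h⟩ := hT
  exact ((EReal.bot_lt_coe _).trans_le (le_supQuadratic h u)).ne'

/-- Each quadratic satisfies the modulus-`σ` inequality with equality, on the whole space, and
suprema preserve it. Allowing `τ ≤ σ` covers global convexity and the modulus `σ` at once. -/
theorem convexOnWithModulus_supQuadratic {f : E → ℝ} {σ τ : ℝ} {T : Set (E × E)}
    (hT : T.Nonempty) (hτ : τ ≤ σ) (U : Set E) :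
    ConvexOnWithModulus U τ (supQuadratic f σ T) := by
  intro x _ y _ a b ha hb hab
  set ψ := supQuadratic f σ T with hψ
  have hbot : ∀ u, ψ u ≠ ⊥ := supQuadratic_ne_bot hT
  have hmul : ∀ (c : ℝ) (u : E), 0 < c → (c : EReal) * ψ u ≠ ⊥ := by
    intro c u hc
    by_cases hu : ψ u = ⊤
    · rw [hu, EReal.coe_mul_top_of_pos hc]; exact top_ne_bot
    · rw [← EReal.coe_toReal hu (hbot u), ← EReal.coe_mul]; exact EReal.coe_ne_bot _
  by_cases hx : ψ x = ⊤
  · rw [hx, EReal.coe_mul_top_of_pos ha, EReal.top_add_of_ne_bot (hmul b y hb)]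
    exact le_top
  by_cases hy : ψ y = ⊤
  · rw [hy, EReal.coe_mul_top_of_pos hb, EReal.add_top_of_ne_bot (hmul a x ha)]
    exact le_top
  obtain ⟨c, hc⟩ : ∃ c : ℝ, ψ x = c := ⟨_, (EReal.coe_toReal hx (hbot x)).symm⟩
  obtain ⟨d, hd⟩ : ∃ d : ℝ, ψ y = d := ⟨_, (EReal.coe_toReal hy (hbot y)).symm⟩
  have hle : ψ (a • x + b • y) ≤
      ((a * c + b * d - a * b * (τ / 2 * ‖x - y‖ ^ 2) : ℝ) : EReal) := by
    refine iSup_le fun p => ?_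
    have h1 := le_supQuadratic (f := f) (σ := σ) p.2 x
    have h2 := le_supQuadratic (f := f) (σ := σ) p.2 y
    rw [← hψ, hc] at h1
    rw [← hψ, hd] at h2
    rw [EReal.coe_le_coe_iff] at h1 h2 ⊢
    have h3 := norm_smul_add_smul_sub_sq (x := x) (y := y) (c := p.1.1) hab
    have h4 : inner ℝ p.1.2 (a • x + b • y - p.1.1) =
        a * inner ℝ p.1.2 (x - p.1.1) + b * inner ℝ p.1.2 (y - p.1.1) := by
      rw [← real_inner_smul_right, ← real_inner_smul_right, ← inner_add_right]
      congr 1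
      obtain rfl : b = 1 - a := by linarith
      module
    have h5 := mul_le_mul_of_nonneg_left h1 ha.le
    have h6 := mul_le_mul_of_nonneg_left h2 hb.le
    have h7 : a * b * (τ / 2 * ‖x - y‖ ^ 2) ≤ a * b * (σ / 2 * ‖x - y‖ ^ 2) := by gcongr
    have h8 : a * f p.1.1 + b * f p.1.1 = f p.1.1 := by rw [← add_mul, hab, one_mul]
    rw [h4]
    linear_combination h5 + h6 + h7 + (σ / 2) * h3 - h8
  rw [hc, hd]
  refine (add_le_add_left hle _).trans ?_
  norm_cast
  linarith

theorem mem_tiltArgmin_constrainedCost {f : E → ℝ} {g : E → F} {Θ : Set F} {x₀ x v : E} {γ : ℝ}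
    (hγ : 0 ≤ γ) (hx₀ : g x₀ ∈ Θ) :
    x ∈ tiltArgmin (constrainedCost f g Θ) x₀ γ v ↔
      x ∈ Metric.closedBall x₀ γ ∧ g x ∈ Θ ∧ ∀ u ∈ Metric.closedBall x₀ γ, g u ∈ Θ →
        f x - inner ℝ v x ≤ f u - inner ℝ v u := by
  constructor
  · rintro ⟨hx, hmin⟩
    have hxΘ : g x ∈ Θ := by
      by_contra hcon
      have := hmin x₀ (Metric.mem_closedBall_self hγ)
      rw [constrainedCost_of_notMem hcon, constrainedCost_of_mem hx₀, EReal.top_sub_coe,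
        ← EReal.coe_sub] at this
      exact EReal.coe_ne_top _ (top_le_iff.1 this)
    refine ⟨hx, hxΘ, fun u hu huΘ => ?_⟩
    have := hmin u hu
    rw [constrainedCost_of_mem hxΘ, constrainedCost_of_mem huΘ] at this
    exact_mod_cast this
  · rintro ⟨hx, hxΘ, hmin⟩
    refine ⟨hx, fun u hu => ?_⟩
    by_cases huΘ : g u ∈ Θ
    · rw [constrainedCost_of_mem hxΘ, constrainedCost_of_mem huΘ]
      exact_mod_cast hmin u hu huΘ
    · rw [constrainedCost_of_notMem huΘ, EReal.top_sub_coe]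
      exact le_top

/-- `ψ` is the supremum of the quadratic minorants attached to the local graph `T`. It touches `φ`
at the points of `T` and keeps their subgradients. That `∂ψ` has no further pairs nearby is a
Minty-type argument: the proximal map solves `z = x + v / s` within `T`, and monotonicity of `∂ψ`
makes the solution unique. -/
theorem HasPositiveGraphicalDerivative.variationallyConvexWithModulus [FiniteDimensional ℝ E]
    [NormedAddCommGroup F]
    {f : E → ℝ} {g : E → F} {Θ : Set F} (hcl : IsClosed Θ) {x₀ : E} {ρ r σ : ℝ}
    (hf : ∀ᶠ x in 𝓝 x₀, ContinuousAt f x) (hg : ∀ᶠ x in 𝓝 x₀, ContinuousAt g x)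
    (H : HasPositiveGraphicalDerivative f (feasibleSet g Θ)
      (limitingSubdiff (constrainedCost f g Θ)) x₀ ρ r σ) :
    VariationallyConvexWithModulus (constrainedCost f g Θ) x₀ 0 σ := by
  have hr := H.prox_pos
  have hσ := H.modulus_nonneg
  obtain ⟨η, hη, hgrow⟩ := H.exists_uniform_growth
  obtain ⟨δ, hδ, P, hP⟩ := H.exists_isLocalProxMap
  set s := 4 * r with hs
  have hspos : 0 < s := by positivity
  -- With `ε = 1` in the definition, continuity of `f` makes the level restriction automatic at
  -- feasible points near `x₀`.
  have hlt : ∀ᶠ x in 𝓝 x₀, f x < f x₀ + 1 :=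
    hf.self_of_nhds.eventually (gt_mem_nhds (lt_add_one _))
  obtain ⟨ρ₁, hρ₁, hball⟩ := Metric.eventually_nhds_iff_ball.1 (hf.and (hg.and hlt))
  set c := (1 + 1 / s) * (4 * s + 3) with hc
  have hc0 : 0 < c := by positivity
  set θ := min (min ρ₁ η) (min (δ / (1 + 1 / s)) (η / c)) with hθ
  have hθ0 : 0 < θ := by positivity
  have hθ1 : θ ≤ ρ₁ := (min_le_left _ _).trans (min_le_left _ _)
  have hθ2 : θ ≤ η := (min_le_left _ _).trans (min_le_right _ _)
  have hθ3 : (1 + 1 / s) * θ ≤ δ := by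
    have : θ ≤ δ / (1 + 1 / s) := (min_le_right _ _).trans (min_le_left _ _)
    rw [le_div_iff₀ (by positivity)] at this
    linarith
  -- Since `‖P z - x₀‖ ≤ 3‖z - x₀‖` and `‖z - P z‖ ≤ 4‖z - x₀‖`, this places the proximal pair of
  -- `z` in `T`.
  have hθ4 : (4 * s + 3) * ((1 + 1 / s) * θ) ≤ η := by
    have : θ ≤ η / c := (min_le_right _ _).trans (min_le_right _ _)
    rw [le_div_iff₀ hc0, hc] at this
    linarith
  have hUη : Metric.ball x₀ θ ⊆ Metric.ball x₀ η := Metric.ball_subset_ball hθ2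
  have hVη : Metric.ball (0 : E) θ ⊆ Metric.ball (0 : E) η := Metric.ball_subset_ball hθ2
  set T : Set (E × E) := {p | p.1 ∈ Metric.ball x₀ η ∧ p.2 ∈ Metric.ball (0 : E) η ∧
    p.2 ∈ limitingSubdiff (constrainedCost f g Θ) p.1} with hT
  have hTne : T.Nonempty :=
    ⟨(x₀, 0), Metric.mem_ball_self hη, Metric.mem_ball_self hη, H.zero_mem⟩
  set ψ := supQuadratic f σ T with hψ
  have hle : ∀ x ∈ Metric.ball x₀ η, ψ x ≤ constrainedCost f g Θ x := by
    refine fun x hx => iSup_le fun p => le_constrainedCost_iff.2 fun hxΘ => ?_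
    exact hgrow _ p.2.1 _ p.2.2.1 p.2.2.2 x hx hxΘ
  have hTΘ : ∀ x v, (x, v) ∈ T → g x ∈ Θ := fun x v h => H.mem_of_mem x v h.2.2
  have hx₀ : g x₀ ∈ Θ := H.base_mem
  have hψT : ∀ x v, (x, v) ∈ T → ψ x = f x := by
    intro x v hxv
    refine le_antisymm ?_ ?_
    · have := hle x hxv.1
      rwa [constrainedCost_of_mem (hTΘ x v hxv)] at this
    · simpa using le_supQuadratic (f := f) (σ := σ) hxv x
  have hψsub : ∀ x v, (x, v) ∈ T → ∀ u, ((f x + inner ℝ v (u - x) : ℝ) : EReal) ≤ ψ u := by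
    intro x v hxv u
    refine le_trans ?_ (le_supQuadratic hxv u)
    rw [EReal.coe_le_coe_iff]
    have : 0 ≤ σ / 2 * ‖u - x‖ ^ 2 := by positivity
    linarith
  have hψlim : ∀ x v, (x, v) ∈ T → v ∈ limitingSubdiff ψ x := by
    intro x v hxv
    refine regularSubdiff_subset_limitingSubdiff _ _ ?_
    have hx := hψT x v hxv
    refine ⟨by rw [hx]; exact EReal.coe_ne_top _, by rw [hx]; exact EReal.coe_ne_bot _,
      fun ε hε => Eventually.of_forall fun u => le_trans ?_ (hψsub x v hxv u)⟩
    rw [hx, ← EReal.coe_add, EReal.coe_le_coe_iff]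
    have : 0 ≤ ε * ‖u - x‖ := by positivity
    linarith
  have hbot : ∀ x, ψ x ≠ ⊥ := supQuadratic_ne_bot hTne
  have hconv : ConvexOnWithModulus Set.univ 0 ψ :=
    convexOnWithModulus_supQuadratic hTne hσ _
  have hback : ∀ x ∈ Metric.ball x₀ θ, ∀ v ∈ Metric.ball (0 : E) θ, v ∈ limitingSubdiff ψ x →
      (x, v) ∈ T := by
    intro x hx v hv hmem
    have hin := hconv.le_of_mem_limitingSubdiff hbot hmem
    set z := x + s⁻¹ • v with hz
    have hzn : ‖z - x₀‖ < (1 + 1 / s) * θ := by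
      rw [mem_ball_iff_norm] at hx
      rw [mem_ball_zero_iff] at hv
      have : z - x₀ = (x - x₀) + s⁻¹ • v := by rw [hz]; abel
      rw [this]
      refine (norm_add_le _ _).trans_lt ?_
      rw [norm_smul, norm_inv, Real.norm_eq_abs, abs_of_pos hspos, add_mul, one_mul, one_div]
      exact add_lt_add hx (mul_lt_mul_of_pos_left hv (by positivity))
    have hzδ : z ∈ Metric.ball x₀ δ := by rw [mem_ball_iff_norm]; linarith
    have hpn := hP.norm_sub_le z hzδ
    have hn := norm_nonneg (z - x₀)
    have hpT : (P z, s • (z - P z)) ∈ T := by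
      refine ⟨?_, ?_, hP.smul_mem z hzδ⟩
      · rw [mem_ball_iff_norm]
        nlinarith
      · have h4 : ‖z - P z‖ ≤ 4 * ‖z - x₀‖ := by
          have := norm_sub_le_norm_sub_add_norm_sub z x₀ (P z)
          rw [norm_sub_rev x₀ (P z)] at this
          linarith
        rw [mem_ball_zero_iff, norm_smul, Real.norm_eq_abs, abs_of_pos hspos]
        nlinarith
    -- The subgradient inequalities of `ψ` at `x` and at `P z` add up to `s‖P z - x‖² ≤ 0`.
    have h1 := hin (P z)
    have h2 := hψsub _ _ hpT x
    rw [hψT _ _ hpT] at h1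
    have hxc := EReal.coe_toReal hmem.1 (hbot x)
    rw [← hxc] at h1 h2
    rw [← EReal.coe_add, EReal.coe_le_coe_iff] at h1
    rw [EReal.coe_le_coe_iff] at h2
    have hveq : s • (z - x) = v := by
      rw [hz, add_sub_cancel_left, smul_smul, mul_inv_cancel₀ hspos.ne', one_smul]
    have h3 : inner ℝ v (P z - x) + inner ℝ (s • (z - P z)) (x - P z) = s * ‖P z - x‖ ^ 2 := by
      rw [← hveq, ← real_inner_self_eq_norm_sq, ← neg_sub (P z) x, inner_neg_right,
        ← sub_eq_add_neg, ← inner_sub_left, ← smul_sub, real_inner_smul_left]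
      rw [show z - x - (z - P z) = P z - x by abel]
    have h4 : ‖P z - x‖ ^ 2 ≤ 0 := by
      refine le_of_mul_le_mul_left ?_ hspos
      linarith
    have h5 : P z = x := by
      have := pow_eq_zero_iff (two_ne_zero) |>.1 (le_antisymm h4 (sq_nonneg _))
      exact sub_eq_zero.1 (norm_eq_zero.1 this)
    rwa [h5, hveq] at hpT
  refine ⟨H.zero_mem, Metric.ball x₀ θ, Metric.ball_mem_nhds _ hθ0, Metric.ball 0 θ,
    Metric.ball_mem_nhds _ hθ0, convex_ball _ _, convex_ball _ _,
    lowerSemicontinuousOn_constrainedCost hcl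
      (fun x hx => (hball x (Metric.ball_subset_ball hθ1 hx)).1)
      (fun x hx => (hball x (Metric.ball_subset_ball hθ1 hx)).2.1),
    ψ, hbot, lowerSemicontinuous_supQuadratic _ _ _, hconv,
    convexOnWithModulus_supQuadratic hTne le_rfl _, fun x hx => hle x (hUη hx), 1, one_pos,
    fun x hx v hv => ⟨fun h => hψlim x v ⟨hUη hx, hVη hv, h.2⟩, fun h => ?_⟩,
    fun x hx v hv h => ?_⟩
  · have hxv := hback x hx v hv h
    refine ⟨?_, hxv.2.2⟩
    rw [constrainedCost_of_mem (hTΘ x v hxv), constrainedCost_of_mem hx₀]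
    exact_mod_cast (hball x (Metric.ball_subset_ball hθ1 hx)).2.2
  · have hxv := hback x hx v hv h
    rw [constrainedCost_of_mem (hTΘ x v hxv), hψT x v hxv]

theorem HasPositiveGraphicalDerivative.eventually_growth [FiniteDimensional ℝ E]
    {f : E → ℝ} {Γ : Set E} {S : E → Set E} {x₀ : E} {ρ r σ : ℝ}
    (H : HasPositiveGraphicalDerivative f Γ S x₀ ρ r σ) :
    ∀ᶠ x in 𝓝 x₀, x ∈ Γ → f x₀ + σ / 2 * ‖x - x₀‖ ^ 2 ≤ f x := by
  obtain ⟨η, hη, hgrow⟩ := H.exists_uniform_growth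
  filter_upwards [Metric.ball_mem_nhds x₀ hη] with x hx hxΓ
  simpa using hgrow x₀ (Metric.mem_ball_self hη) 0 (Metric.mem_ball_self hη) H.zero_mem x hx hxΓ

/-- A minimizer interior to the ball has `v` as a subgradient, so uniform growth applies there.
Adding it for two tilts gives `σ‖x₁ - x₂‖² ≤ ⟨v₁ - v₂, x₁ - x₂⟩`, hence both uniqueness and the
Lipschitz constant. -/
theorem HasPositiveGraphicalDerivative.isTiltStableLocalMinimizer [FiniteDimensional ℝ E]
    {f : E → ℝ} {g : E → F} {Θ : Set F} {x₀ : E} {ρ r σ : ℝ} (hσ : 0 < σ)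
    (H : HasPositiveGraphicalDerivative f (feasibleSet g Θ)
      (limitingSubdiff (constrainedCost f g Θ)) x₀ ρ r σ) :
    IsTiltStableLocalMinimizer (constrainedCost f g Θ) x₀ σ⁻¹ := by
  have hρ := H.radius_pos
  obtain ⟨η, hη, hgrow⟩ := H.exists_uniform_growth
  have hx₀ : g x₀ ∈ Θ := H.base_mem
  set γ := min (η / 2) (ρ / 2) with hγ
  have hγ0 : 0 < γ := by positivity
  have hγη : Metric.closedBall x₀ γ ⊆ Metric.ball x₀ η :=
    Metric.closedBall_subset_ball ((min_le_left _ _).trans_lt (by linarith))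
  -- Growth at `x₀` gives `‖x - x₀‖ ≤ 2‖v‖ / σ`, so the first bound keeps minimizers off the
  -- boundary of the ball of radius `γ`.
  set θ := min (σ * γ / 2) η with hθ
  have hθ0 : 0 < θ := by positivity
  have hmem : ∀ v ∈ Metric.ball (0 : E) θ, ∀ x ∈ tiltArgmin (constrainedCost f g Θ) x₀ γ v,
      ‖x - x₀‖ ≤ 2 / σ * ‖v‖ ∧ ∀ u ∈ Metric.closedBall x₀ γ, g u ∈ Θ →
        f x + inner ℝ v (u - x) + σ / 2 * ‖u - x‖ ^ 2 ≤ f u := by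
    intro v hv x hx
    rw [mem_ball_zero_iff] at hv
    obtain ⟨hxB, hxΘ, hmin⟩ := (mem_tiltArgmin_constrainedCost hγ0.le hx₀).1 hx
    have h1 := hmin x₀ (Metric.mem_closedBall_self hγ0.le) hx₀
    have h2 := hgrow x₀ (Metric.mem_ball_self hη) 0 (Metric.mem_ball_self hη) H.zero_mem x
      (hγη hxB) hxΘ
    rw [inner_zero_left] at h2
    have h3 : inner ℝ v x - inner ℝ v x₀ ≤ ‖v‖ * ‖x - x₀‖ := by
      rw [← inner_sub_right]; exact real_inner_le_norm _ _
    have hb : ‖x - x₀‖ ≤ 2 / σ * ‖v‖ := by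
      rw [div_mul_eq_mul_div, le_div_iff₀ hσ]
      by_contra hcon
      push Not at hcon
      nlinarith [norm_nonneg (x - x₀), norm_nonneg v]
    refine ⟨hb, fun u hu huΘ => ?_⟩
    have hxγ : x ∈ Metric.ball x₀ γ := by
      rw [mem_ball_iff_norm]
      refine hb.trans_lt ?_
      have : ‖v‖ < σ * γ / 2 := hv.trans_le (min_le_left _ _)
      rw [div_mul_eq_mul_div, div_lt_iff₀ hσ]
      linarith
    have hreg : v ∈ regularSubdiff (constrainedCost f g Θ) x := by
      refine mem_regularSubdiff_of_eventually_le hxΘ le_rfl ?_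
      filter_upwards [Metric.isOpen_ball.mem_nhds hxγ] with u hu huΘ
      have := hmin u (Metric.ball_subset_closedBall hu) huΘ
      rw [inner_sub_right]
      linarith
    exact hgrow x (hγη hxB) v (by rw [mem_ball_zero_iff]; exact hv.trans_le (min_le_right _ _))
      (regularSubdiff_subset_limitingSubdiff _ _ hreg) u (hγη hu) huΘ
  have hex : ∀ v : E, ∃ x, x ∈ tiltArgmin (constrainedCost f g Θ) x₀ γ v := by
    intro v
    have hsub : feasibleSet g Θ ∩ Metric.closedBall x₀ γ ⊆
        feasibleSet g Θ ∩ Metric.closedBall x₀ (ρ / 2) :=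
      Set.inter_subset_inter_right _ (Metric.closedBall_subset_closedBall (min_le_right _ _))
    have hk : IsCompact (feasibleSet g Θ ∩ Metric.closedBall x₀ γ) := by
      have := H.isCompact.inter_right (Metric.isClosed_closedBall (x := x₀) (ε := γ))
      rwa [Set.inter_assoc, Set.inter_eq_self_of_subset_right
        (Metric.closedBall_subset_closedBall (min_le_right (η / 2) (ρ / 2)))] at this
    have hcont : ContinuousOn (fun x => f x - inner ℝ v x)
        (feasibleSet g Θ ∩ Metric.closedBall x₀ γ) := by
      refine ContinuousOn.sub (H.continuousOn.mono ?_) (Continuous.continuousOn (by fun_prop))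
      exact hsub.trans (Set.inter_subset_right.trans
        (Metric.closedBall_subset_ball (by linarith)))
    obtain ⟨x, ⟨hxΘ, hxB⟩, hmin⟩ :=
      hk.exists_isMinOn ⟨x₀, hx₀, Metric.mem_closedBall_self hγ0.le⟩ hcont
    exact ⟨x, (mem_tiltArgmin_constrainedCost hγ0.le hx₀).2
      ⟨hxB, hxΘ, fun u hu huΘ => hmin ⟨huΘ, hu⟩⟩⟩
  choose m hm using hex
  have hmono : ∀ v₁ ∈ Metric.ball (0 : E) θ, ∀ v₂ ∈ Metric.ball (0 : E) θ, ∀ x₁ x₂,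
      x₁ ∈ tiltArgmin (constrainedCost f g Θ) x₀ γ v₁ →
      x₂ ∈ tiltArgmin (constrainedCost f g Θ) x₀ γ v₂ → ‖x₁ - x₂‖ ≤ σ⁻¹ * ‖v₁ - v₂‖ := by
    intro v₁ hv₁ v₂ hv₂ x₁ x₂ hx₁ hx₂
    obtain ⟨hB₁, hΘ₁, -⟩ := (mem_tiltArgmin_constrainedCost hγ0.le hx₀).1 hx₁
    obtain ⟨hB₂, hΘ₂, -⟩ := (mem_tiltArgmin_constrainedCost hγ0.le hx₀).1 hx₂
    have h1 := (hmem v₁ hv₁ x₁ hx₁).2 x₂ hB₂ hΘ₂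
    have h2 := (hmem v₂ hv₂ x₂ hx₂).2 x₁ hB₁ hΘ₁
    rw [norm_sub_rev x₂ x₁] at h1
    have h3 : inner ℝ v₁ (x₂ - x₁) + inner ℝ v₂ (x₁ - x₂) = -inner ℝ (v₁ - v₂) (x₁ - x₂) := by
      rw [← neg_sub x₁ x₂, inner_neg_right, inner_sub_left]; ring
    have h4 := real_inner_le_norm (v₁ - v₂) (x₁ - x₂)
    rw [inv_mul_eq_div, le_div_iff₀ hσ]
    by_contra hcon
    push Not at hcon
    nlinarith [norm_nonneg (x₁ - x₂), norm_nonneg (v₁ - v₂)]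
  have hsing : ∀ v ∈ Metric.ball (0 : E) θ,
      tiltArgmin (constrainedCost f g Θ) x₀ γ v = {m v} := by
    intro v hv
    refine Set.eq_singleton_iff_unique_mem.2 ⟨hm v, fun x hx => ?_⟩
    have := hmono v hv v hv x (m v) hx (hm v)
    rw [sub_self, norm_zero, mul_zero] at this
    exact sub_eq_zero.1 (norm_le_zero_iff.1 this)
  have hzero : (0 : E) ∈ Metric.ball (0 : E) θ := Metric.mem_ball_self hθ0
  refine ⟨by positivity, by rw [constrainedCost_of_mem hx₀]; exact EReal.coe_ne_top _, γ, hγ0, ?_,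
    Metric.ball 0 θ, Metric.ball_mem_nhds _ hθ0, m, hsing,
    fun v₁ hv₁ v₂ hv₂ => hmono v₁ hv₁ v₂ hv₂ _ _ (hm v₁) (hm v₂)⟩
  have h0 := (hmem 0 hzero _ (hm 0)).1
  rw [norm_zero, mul_zero] at h0
  rw [hsing 0 hzero, sub_eq_zero.1 (norm_le_zero_iff.1 h0)]

end Consequences

/-! ### The constrained problem satisfies the abstract hypotheses. -/

section Constrained

variable {E F : Type*} [NormedAddCommGroup E] [InnerProductSpace ℝ E] [FiniteDimensional ℝ E]
  [NormedAddCommGroup F] [InnerProductSpace ℝ F] [FiniteDimensional ℝ F]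

/-- The second-order condition makes the graphical derivative of `∂(f + δ_Γ)` positive near the
reference point. -/
theorem SecondOrderCondition.hasPositiveGraphicalDerivative {f : E → ℝ} {g : E → F} {Θ : Set F}
    (hΘ : Convex ℝ Θ) (hcl : IsClosed Θ) {x₀ : E} (hf : ContDiffAt ℝ 2 f x₀)
    (hg : ContDiffAt ℝ 2 g x₀) (hfirst : FirstOrderCondition f g Θ x₀) (hM : MSCQ g Θ x₀) {σ : ℝ}
    (hσ : 0 ≤ σ) (hsoc : SecondOrderCondition f g Θ x₀ σ) :
    ∃ ρ r : ℝ, HasPositiveGraphicalDerivative f (feasibleSet g Θ)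
      (limitingSubdiff (constrainedCost f g Θ)) x₀ ρ r σ := by
  obtain ⟨U, hU, V, hV, hsoc⟩ := hsoc
  obtain ⟨ρ₁, hρ₁, C, -, hmul⟩ := exists_bounded_multiplier hΘ hcl hf hg hM
  obtain ⟨ρ₂, hρ₂, r, hr, hprox⟩ := exists_prox_regular hΘ hcl hf hg hM
  obtain ⟨ρ₃, hρ₃, hball⟩ := Metric.eventually_nhds_iff_ball.1
    ((hf.eventually (by simp)).and ((hg.eventually (by simp)).and hU))
  obtain ⟨ρ₄, hρ₄, hV'⟩ := Metric.mem_nhds_iff.1 hV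
  set ρ := min (min ρ₁ ρ₂) (min ρ₃ ρ₄) with hρ
  have hρ0 : 0 < ρ := by positivity
  have h1 : ρ ≤ ρ₁ := (min_le_left _ _).trans (min_le_left _ _)
  have h2 : ρ ≤ ρ₂ := (min_le_left _ _).trans (min_le_right _ _)
  have h3 : ρ ≤ ρ₃ := (min_le_right _ _).trans (min_le_left _ _)
  have h4 : ρ ≤ ρ₄ := (min_le_right _ _).trans (min_le_right _ _)
  obtain ⟨ybar, hybar, h0⟩ := hfirst
  refine ⟨ρ, r, hρ0, hr, hσ, ?_, ?_, hM.1, ?_, ?_, ?_, ?_, ?_⟩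
  · exact fun x hx => (hball x (Metric.ball_subset_ball h3 hx)).1.continuousAt.continuousWithinAt
  · have hgc : ContinuousOn g (Metric.closedBall x₀ (ρ / 2)) := fun x hx =>
      (hball x (Metric.closedBall_subset_ball (by linarith) hx)).2.1.continuousAt.continuousWithinAt
    rw [Set.inter_comm]
    exact (isCompact_closedBall _ _).of_isClosed_subset
      (hgc.preimage_isClosed_of_isClosed Metric.isClosed_closedBall hcl) Set.inter_subset_left
  · exact regularSubdiff_subset_limitingSubdiff _ _ (zero_mem_regularSubdiff
      (hf.differentiableAt (by simp)) (hg.differentiableAt (by simp))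
      (normalCone_subset_convexNormalCone hΘ _ hybar) h0)
  · exact fun x v hv => mem_of_mem_limitingSubdiff_constrainedCost hv
  · intro x hx z s hs hmin
    refine regularSubdiff_subset_limitingSubdiff _ _
      (mem_regularSubdiff_of_eventually_le hx (half_pos hs).le ?_)
    filter_upwards [eventually_nhdsWithin_iff.1 hmin] with u hu huΘ
    have h5 : f x + s / 2 * ‖x - z‖ ^ 2 ≤ f u + s / 2 * ‖u - z‖ ^ 2 := hu huΘ
    have h6 : ‖u - z‖ ^ 2 = ‖u - x‖ ^ 2 - 2 * inner ℝ (z - x) (u - x) + ‖x - z‖ ^ 2 := by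
      have : u - z = (u - x) - (z - x) := by abel
      rw [this, norm_sub_sq_real, norm_sub_rev z x, real_inner_comm]
    rw [real_inner_smul_left]
    rw [h6] at h5
    linarith
  · exact fun x hx v hv hmem u hu huΘ => hprox x (Metric.ball_subset_ball h2 hx) v
      (Metric.ball_subset_ball h2 hv) hmem u (Metric.ball_subset_ball h2 hu) huΘ
  · intro x hx v hv hmem t ws qs w q ht htlim hw hq hall
    obtain ⟨c1, c2, c3⟩ := hball x (Metric.ball_subset_ball h3 hx)
    refine SecondOrderCondition.le_inner hsoc c3 (hV' (Metric.ball_subset_ball h4 hv)) c1 c2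
      (mem_of_mem_limitingSubdiff_constrainedCost hmem) (C := C) ht htlim hw hq fun k => ?_
    obtain ⟨a1, a2, a3⟩ := hall k
    exact (hmul _ (Metric.ball_subset_ball h1 a1) _ (Metric.ball_subset_ball h1 a2) a3).2

end Constrained

end VariationalAnalysis

open VariationalAnalysis in
theorem theorem8p3 {n m : ℕ}
    (f : EuclideanSpace ℝ (Fin n) → ℝ)
    (g : EuclideanSpace ℝ (Fin n) → EuclideanSpace ℝ (Fin m))
    (Θ : Set (EuclideanSpace ℝ (Fin m))) (hΘ : IsConvexPolyhedron Θ)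
    (xbar : EuclideanSpace ℝ (Fin n))
    (hf : ContDiffAt ℝ 2 f xbar) (hg : ContDiffAt ℝ 2 g xbar)
    (hfirst : FirstOrderCondition f g Θ xbar)
    (hMSCQ : MSCQ g Θ xbar) :
    (SecondOrderCondition f g Θ xbar 0 →
      VariationallyConvex (constrainedCost f g Θ) xbar 0 ∧
      (xbar ∈ feasibleSet g Θ ∧ IsLocalMinOn f (feasibleSet g Θ) xbar)) ∧
    (∀ σ : ℝ, 0 < σ → SecondOrderCondition f g Θ xbar σ →
      StronglyVariationallyConvex (constrainedCost f g Θ) xbar 0 σ ∧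
      IsStrongLocalMinimizer (constrainedCost f g Θ) xbar σ ∧
      IsTiltStableLocalMinimizer (constrainedCost f g Θ) xbar σ⁻¹) := by
  have hfc : ∀ᶠ x in 𝓝 xbar, ContinuousAt f x :=
    (hf.eventually (by simp)).mono fun x hx => hx.continuousAt
  have hgc : ∀ᶠ x in 𝓝 xbar, ContinuousAt g x :=
    (hg.eventually (by simp)).mono fun x hx => hx.continuousAt
  have hxΘ : g xbar ∈ Θ := hMSCQ.1
  refine ⟨fun hsoc => ?_, fun σ hσ hsoc => ?_⟩
  · obtain ⟨ρ, r, H⟩ := hsoc.hasPositiveGraphicalDerivative hΘ.convex hΘ.isClosed hf hg hfirst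
      hMSCQ le_rfl
    refine ⟨H.variationallyConvexWithModulus hΘ.isClosed hfc hgc, hMSCQ.1, ?_⟩
    refine eventually_nhdsWithin_iff.2 (H.eventually_growth.mono fun x hx hxΓ => ?_)
    simpa using hx hxΓ
  · obtain ⟨ρ, r, H⟩ := hsoc.hasPositiveGraphicalDerivative hΘ.convex hΘ.isClosed hf hg hfirst
      hMSCQ hσ.le
    refine ⟨⟨hσ, H.variationallyConvexWithModulus hΘ.isClosed hfc hgc⟩, ⟨hσ, ?_, ?_⟩,
      H.isTiltStableLocalMinimizer hσ⟩
    · rw [constrainedCost_of_mem hxΘ]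
      exact EReal.coe_ne_top _
    · filter_upwards [H.eventually_growth] with x hx
      rw [constrainedCost_of_mem hxΘ, ← EReal.coe_add, le_constrainedCost_iff]
      exact hx
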